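/- For a multi-index $\alpha=(\alpha_1,\dots,\alpha_n)$ of non-negative integers and $z\in\mathbb{C}^n$ write $z^\alpha=z_1^{\alpha_1}\cdots z_n^{\alpha_n}$. For $1\le p<\infty$ let $B_p^n=\{z\in\mathbb{C}^n:\sum_{j=1}^n|z_j|^p<1\}$, and let $B_\infty^n=\{z\in\mathbb{C}^n:\max_j|z_j|<1\}$. The Bohr radius $K(G)$ of a domain $G\subset\mathbb{C}^n$ is the largest $r\ge 0$ such that, whenever a power series $\sum_\alpha c_\alpha z^\alpha$ with complex coefficients converges (unconditionally) and satisfies $\left|\sum_\alpha c_\alpha z^\alpha\right|\le 1$ for all $z\in G$, then $\sum_\alpha|c_\alpha z^\alpha|\le 1$ for all $z\in rG$. **Theorem.** Let $n>1$ be an integer and let $1\le p\le\infty$. Then the largest such $r$ exists for $G=B_p^n$, and the Bohr radius $K(B_p^n)$ satisfies the following bounds. - If $1\le p\le 2$, then $$\frac{1}{3\sqrt[3]{e}}\cdot\left(\frac1n\right)^{1-\frac1p}\le K(B_p^n)<3\cdot\left(\frac{\log n}{n}\right)^{1-\frac1p}.$$ - If $2\le p\le\infty$, then $$\frac13\cdot\sqrt{\frac1n}\le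 K(B_p^n)<2\cdot\sqrt{\frac{\log n}{n}}.$$ Here $\log$ is the natural logarithm. -/

import Mathlib

open scoped ENNReal Pointwise

/-- The value at `z` of the term `c_α z^α = c_α z_1^{α_1} ⋯ z_n^{α_n}` of the power series with
coefficients `c`. -/
noncomputable def psTerm {n : ℕ} (c : (Fin n → ℕ) → ℂ) (z : Fin n → ℂ) (α : Fin n → ℕ) : ℂ :=
  c α * ∏ j, z j ^ α j

/-- The power series `∑_α c_α z^α` converges (unconditionally) at every point of `G` and its sum
has modulus at most `1` there. -/
def SumBoundedOn {n : ℕ} (c : (Fin n → ℕ) → ℂ) (G : Set (Fin n → ℂ)) : Prop :=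
  ∀ z ∈ G, Summable (psTerm c z) ∧ ‖∑' α, psTerm c z α‖ ≤ 1

/-- `∑_α |c_α z^α| ≤ 1` (in particular this series converges) at every point of `G`. -/
def MajorantBoundedOn {n : ℕ} (c : (Fin n → ℕ) → ℂ) (G : Set (Fin n → ℂ)) : Prop :=
  ∀ z ∈ G, Summable (fun α => ‖psTerm c z α‖) ∧ ∑' α, ‖psTerm c z α‖ ≤ 1

/-- The radii `r ≥ 0` such that every power series whose sum is bounded by `1` on `G` satisfies
`∑_α |c_α z^α| ≤ 1` on the scaled domain `r G`. -/
def bohrRadii {n : ℕ} (G : Set (Fin n → ℂ)) : Set ℝ :=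
  {r | 0 ≤ r ∧ ∀ c : (Fin n → ℕ) → ℂ, SumBoundedOn c G → MajorantBoundedOn c (r • G)}

/-- The Bohr radius `K(G)` of a domain `G` in `ℂⁿ`. -/
noncomputable def bohrRadius {n : ℕ} (G : Set (Fin n → ℂ)) : ℝ :=
  sSup (bohrRadii G)

/-- The open unit ball `B_p^n` of the complex space `ℓ_p^n`, where `1 ≤ p ≤ ∞`. -/
def lpUnitBall (p : ℝ≥0∞) (n : ℕ) : Set (Fin n → ℂ) :=
  {z | ‖(WithLp.toLp p z : PiLp p (fun _ : Fin n => ℂ))‖ < 1}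

/-! Lower bounds. On a Reinhardt set, restricting a bounded series to the circles `ζ w` and
integrating against a nonnegative kernel `1 + cos` bounds its part of degree `k` by `2 (1 - |c_0|)`.
So `r` is admissible once the moduli of the degree-`k` terms on `r G` sum to at most `2 (1 - |c_0|)
s k` with `∑_{k ≥ 1} s k ≤ 1/2` (`mem_bohrRadii_of_homogeneous`). Bessel on the torus and
Cauchy–Schwarz over at most `n ^ k` monomials allow `s k = 3 ^ (-k)` at `r = 1 / (3 √n)`. For `p <
∞`, Cauchy's estimate at the points `t α / k` (`norm_coeff_le`) and the multinomial theorem allow `s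
k = k^k / k! * ρ^k`. Since `∑ k^k / k! (x e^{-x})^k = 1 / (1 - x)`, the choice `x = 1/3`, that is `ρ
= 1 / (3 e^{1/3})`, makes the tail exactly `1/2`.

Upper bounds. The majorant of `∑ ± (d! / α!) z^α` is `(∑ |z_j|)^d`, whatever the signs, but some
signs keep the polynomial below `√(16 d n d!)` on the Euclidean ball (`exists_signPoly_le`:
exponential moments and a net). Scaling (`p ≥ 2`) or interpolation with the trivial bound on the
`ℓ_1` ball (`p ≤ 2`) moves this to the `ℓ_p` ball; comparing the two at diagonal points with `d =
⌈log n⌉` bounds `r`. When `log n ≤ 5`, one-variable Möbius maps already force `r` close enough to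
`1/3`. -/

/-! ### Nets, random signs and Lipschitz bounds -/

/-- A finite `δ`-separated subset of the closed unit ball of a real normed space of dimension `D`
has at most `(1 + 2 / δ) ^ D` elements. -/
theorem card_le_of_separated_unit_ball {E : Type*} [NormedAddCommGroup E] [NormedSpace ℝ E]
    [FiniteDimensional ℝ E] {δ : ℝ} (hδ : 0 < δ) (s : Finset E) (hs : ∀ c ∈ s, ‖c‖ ≤ 1)
    (h : ∀ c ∈ s, ∀ d ∈ s, c ≠ d → δ ≤ ‖c - d‖) :
    (s.card : ℝ) ≤ (1 + 2 / δ) ^ Module.finrank ℝ E := by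
  borelize E
  let μ : MeasureTheory.Measure E := MeasureTheory.Measure.addHaar
  have hδ2 : 0 < δ / 2 := by positivity
  have hρ : 0 < 1 + δ / 2 := by positivity
  have D : Set.Pairwise (s : Set E)
      (Function.onFun Disjoint fun c => Metric.ball (c : E) (δ / 2)) := by
    rintro c hc d hd hcd
    apply Metric.ball_disjoint_ball
    rw [dist_eq_norm]
    linarith [h c hc d hd hcd]
  have hsub : (⋃ c ∈ s, Metric.ball (c : E) (δ / 2)) ⊆ Metric.ball (0 : E) (1 + δ / 2) := by
    refine Set.iUnion₂_subset fun x hx => Metric.ball_subset_ball' ?_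
    rw [dist_zero_right]
    linarith [hs x hx]
  -- Volume comparison: the disjoint balls of radius `δ / 2` all lie in the ball of radius `1 + δ /
  -- 2`.
  have I : (s.card : ℝ≥0∞) * ENNReal.ofReal ((δ / 2) ^ Module.finrank ℝ E) *
      μ (Metric.ball 0 1) ≤
      ENNReal.ofReal ((1 + δ / 2) ^ Module.finrank ℝ E) * μ (Metric.ball 0 1) :=
    calc
      _ = μ (⋃ c ∈ s, Metric.ball (c : E) (δ / 2)) := by
        rw [MeasureTheory.measure_biUnion_finset D fun c _ => measurableSet_ball]
        simp only [μ.addHaar_ball_of_pos _ hδ2, Finset.sum_const, nsmul_eq_mul, mul_assoc]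
      _ ≤ μ (Metric.ball (0 : E) (1 + δ / 2)) := MeasureTheory.measure_mono hsub
      _ = _ := by simp only [μ.addHaar_ball_of_pos _ hρ]
  have J := (ENNReal.mul_le_mul_iff_left
    (Metric.measure_ball_pos μ _ zero_lt_one).ne' MeasureTheory.measure_ball_lt_top.ne).1 I
  have K := ENNReal.toReal_le_of_le_ofReal (pow_nonneg hρ.le _) J
  rw [ENNReal.toReal_mul, ENNReal.toReal_natCast,
    ENNReal.toReal_ofReal (by positivity)] at K
  have : (1 + 2 / δ) = (1 + δ / 2) / (δ / 2) := by field_simp; ring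
  rw [this, div_pow, le_div_iff₀ (by positivity)]
  exact K

/-- The closed unit ball of a real normed space of dimension `D` has a `δ`-net with at most
`(1 + 2 / δ) ^ D` elements. -/
theorem exists_net_unit_ball (E : Type*) [NormedAddCommGroup E] [NormedSpace ℝ E]
    [FiniteDimensional ℝ E] {δ : ℝ} (hδ : 0 < δ) :
    ∃ s : Finset E, (∀ c ∈ s, ‖c‖ ≤ 1) ∧ (∀ x : E, ‖x‖ ≤ 1 → ∃ c ∈ s, ‖x - c‖ ≤ δ) ∧
      (s.card : ℝ) ≤ (1 + 2 / δ) ^ Module.finrank ℝ E := by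
  classical
  by_contra! H
  -- If no small net exists, a separated set, being small by packing, is never a net and can be
  -- enlarged forever; packing then gives a contradiction.
  have key : ∀ k : ℕ, ∃ s : Finset E, (∀ c ∈ s, ‖c‖ ≤ 1) ∧
      (∀ c ∈ s, ∀ d ∈ s, c ≠ d → δ ≤ ‖c - d‖) ∧ s.card = k := by
    intro k
    induction k with
    | zero => exact ⟨∅, by simp⟩
    | succ k ih =>
      obtain ⟨s, h1, h2, h3⟩ := ih
      have : ∃ x : E, ‖x‖ ≤ 1 ∧ ∀ c ∈ s, δ < ‖x - c‖ := by
        by_contra! h4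
        exact absurd (card_le_of_separated_unit_ball hδ s h1 h2) (not_le.2 (H s h1 h4))
      obtain ⟨x, hx1, hx⟩ := this
      have hxs : x ∉ s := fun hxs => by
        have := hx x hxs
        simp at this
        linarith
      refine ⟨insert x s, ?_, ?_, by rw [Finset.card_insert_of_notMem hxs, h3]⟩
      · intro c hc
        rcases Finset.mem_insert.1 hc with rfl | hc
        exacts [hx1, h1 c hc]
      · intro c hc d hd hcd
        rcases Finset.mem_insert.1 hc with e | hc' <;> rcases Finset.mem_insert.1 hd with e' | hd'
        · exact absurd (e.trans e'.symm) hcd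
        · rw [e]; exact (hx d hd').le
        · rw [e', norm_sub_rev]; exact (hx c hc').le
        · exact h2 c hc' d hd' hcd
  obtain ⟨k, hk⟩ := exists_nat_gt ((1 + 2 / δ) ^ Module.finrank ℝ E)
  obtain ⟨s, h1, h2, h3⟩ := key k
  have := card_le_of_separated_unit_ball hδ s h1 h2
  rw [h3] at this
  linarith

/-- The exponential moment of a Rademacher sum. -/
theorem sum_signs_exp_le {A : Type*} [Fintype A] [DecidableEq A] (x : A → ℝ) :
    ∑ ε : A → Bool, Real.exp (∑ a, (if ε a then 1 else -1) * x a) ≤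
      2 ^ Fintype.card A * Real.exp ((∑ a, x a ^ 2) / 2) := by
  have h1 : ∑ ε : A → Bool, Real.exp (∑ a, (if ε a then 1 else -1) * x a) =
      ∏ a, (2 * Real.cosh (x a)) := by
    simp_rw [Real.exp_sum]
    rw [← Fintype.piFinset_univ]
    refine (Finset.prod_univ_sum (fun _ => Finset.univ)
      (fun a (b : Bool) => Real.exp ((if b then 1 else -1) * x a))).symm.trans ?_
    refine Finset.prod_congr rfl fun a _ => ?_
    rw [Fintype.sum_bool, Real.cosh_eq]
    simp only [if_true, Bool.false_eq_true, if_false, one_mul, neg_mul]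
    ring
  rw [h1, Finset.prod_mul_distrib, Finset.prod_const, Finset.sum_div, Real.exp_sum]
  refine mul_le_mul_of_nonneg_left ?_ (by positivity)
  exact Finset.prod_le_prod (fun a _ => (Real.cosh_pos _).le)
    fun a _ => Real.cosh_le_exp_half_sq _

/-- There are signs for which finitely many linear forms are simultaneously small. -/
theorem exists_signs_sum_le {A T : Type*} [Fintype A] (s : Finset T) (x : T → A → ℝ) {V B : ℝ}
    (hV : 0 < V) (hB : 0 < B) (hx : ∀ t ∈ s, ∑ a, x t a ^ 2 ≤ V)
    (hs : (s.card : ℝ) ≤ Real.exp B) :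
    ∃ ε : A → ℝ, (∀ a, ε a = 1 ∨ ε a = -1) ∧
      ∀ t ∈ s, ∑ a, ε a * x t a ≤ Real.sqrt (2 * V * B) := by
  classical
  -- This Chernoff parameter balances `l² V / 2 = B`: moment and union bound each cost `exp B`, and
  -- the threshold is `2 B / l = √(2 V B)`.
  set l : ℝ := Real.sqrt (2 * B / V) with hl
  have hl0 : 0 < l := Real.sqrt_pos.2 (by positivity)
  have hl2 : l ^ 2 = 2 * B / V := Real.sq_sqrt (by positivity)
  have hsum : ∑ ε : A → Bool, ∑ t ∈ s,
      Real.exp (∑ a, (if ε a then 1 else -1) * (l * x t a)) ≤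
      ∑ _ε : A → Bool, Real.exp (2 * B) := by
    rw [Finset.sum_comm, Finset.sum_const, Finset.card_univ, Fintype.card_fun, Fintype.card_bool,
      nsmul_eq_mul]
    calc _ ≤ ∑ t ∈ s, 2 ^ Fintype.card A * Real.exp B := by
          refine Finset.sum_le_sum fun t ht => (sum_signs_exp_le _).trans ?_
          gcongr
          simp_rw [mul_pow]
          rw [← Finset.mul_sum, hl2]
          have : 2 * B / V * ∑ a, x t a ^ 2 ≤ 2 * B / V * V := by gcongr; exact hx t ht
          have e : 2 * B / V * V = 2 * B := by field_simp
          linarith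
      _ = 2 ^ Fintype.card A * Real.exp B * s.card := by
          rw [Finset.sum_const, nsmul_eq_mul]; ring
      _ ≤ 2 ^ Fintype.card A * Real.exp B * Real.exp B := by gcongr
      _ = _ := by rw [two_mul B, Real.exp_add]; push_cast; ring
  obtain ⟨ε, -, hε⟩ := Finset.exists_le_of_sum_le Finset.univ_nonempty hsum
  refine ⟨fun a => if ε a then 1 else -1, fun a => by by_cases h : ε a <;> simp [h],
    fun t ht => ?_⟩
  have h1 : Real.exp (∑ a, (if ε a then 1 else -1) * (l * x t a)) ≤ Real.exp (2 * B) :=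
    (Finset.single_le_sum
      (f := fun t => Real.exp (∑ a, (if ε a then 1 else -1) * (l * x t a)))
      (fun _ _ => (Real.exp_pos _).le) ht).trans hε
  have h2 := Real.exp_le_exp.1 h1
  have h3 : ∑ a, (if ε a then (1 : ℝ) else -1) * (l * x t a) =
      l * ∑ a, (if ε a then (1 : ℝ) else -1) * x t a := by
    rw [Finset.mul_sum]; exact Finset.sum_congr rfl fun a _ => by ring
  rw [h3] at h2
  have h4 : l * Real.sqrt (2 * V * B) = 2 * B := by
    rw [hl, ← Real.sqrt_mul (by positivity)]
    have : 2 * B / V * (2 * V * B) = (2 * B) ^ 2 := by field_simp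
    rw [this, Real.sqrt_sq (by positivity)]
  exact le_of_mul_le_mul_left (h2.trans_eq h4.symm) hl0

/-- A homogeneous polynomial of degree `d` bounded by `M` on the closed unit ball is Lipschitz
there at small scale. -/
theorem norm_sub_le_of_homogeneous {E : Type*} [NormedAddCommGroup E] [NormedSpace ℂ E]
    {f : E → ℂ} {d : ℕ} (hd : 0 < d) (hhom : ∀ (c : ℂ) (z : E), f (c • z) = c ^ d * f z)
    (hdiff : ∀ w u : E, Differentiable ℂ fun t : ℂ => f (w + t • u)) {M : ℝ}
    (hM : ∀ z, ‖z‖ ≤ 1 → ‖f z‖ ≤ M) {w z : E} (hw : ‖w‖ ≤ 1) (hzw : ‖z - w‖ < 1 / d) :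
    ‖f z - f w‖ ≤ 4 * d * M * ‖z - w‖ := by
  have hd' : (0 : ℝ) < d := by exact_mod_cast hd
  have hM0 : 0 ≤ M := (norm_nonneg _).trans (hM 0 (by simp))
  rcases eq_or_ne z w with rfl | hne
  · simp
  have hpos : 0 < ‖z - w‖ := norm_pos_iff.2 (sub_ne_zero.2 hne)
  -- Enlarging the ball by `1 + 1 / d` costs a factor at most `(1 + 1 / d)^d ≤ e < 3`.
  have hbound : ∀ v : E, ‖v‖ ≤ 1 + 1 / d → ‖f v‖ ≤ 3 * M := by
    intro v hv
    have h1 : (0 : ℝ) < 1 + 1 / d := by positivity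
    have hc : ((1 + 1 / d : ℝ) : ℂ) ≠ 0 := by exact_mod_cast h1.ne'
    have e : v = ((1 + 1 / d : ℝ) : ℂ) • (((1 + 1 / d : ℝ) : ℂ)⁻¹ • v) := by
      rw [smul_smul, mul_inv_cancel₀ hc, one_smul]
    rw [e, hhom, norm_mul, norm_pow, Complex.norm_real, Real.norm_of_nonneg h1.le]
    have h2 : ‖f (((1 + 1 / d : ℝ) : ℂ)⁻¹ • v)‖ ≤ M := by
      apply hM
      rw [norm_smul, norm_inv, Complex.norm_real, Real.norm_of_nonneg h1.le, inv_mul_le_iff₀ h1]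
      simpa using hv
    have h3 : (1 + 1 / d : ℝ) ^ d ≤ 3 := by
      have h4 : (1 + 1 / d : ℝ) ≤ Real.exp (1 / d) := by
        linarith [Real.add_one_le_exp (1 / d : ℝ)]
      calc (1 + 1 / d : ℝ) ^ d ≤ Real.exp (1 / d) ^ d := by gcongr
        _ = Real.exp 1 := by rw [← Real.exp_nat_mul]; congr 1; field_simp
        _ ≤ 3 := by linarith [Real.exp_one_lt_d9]
    gcongr
  set u : E := ((‖z - w‖ : ℝ) : ℂ)⁻¹ • (z - w) with hu
  have hu1 : ‖u‖ = 1 := by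
    rw [hu, norm_smul, norm_inv, Complex.norm_real, norm_norm, inv_mul_cancel₀ hpos.ne']
  have hz : w + ((‖z - w‖ : ℝ) : ℂ) • u = z := by
    rw [hu, smul_smul, mul_inv_cancel₀ (by exact_mod_cast hpos.ne'), one_smul]; abel
  -- Schwarz lemma on the disc of radius `1 / d` along the direction `u`; `4 M` is `3 M` at the
  -- moving point plus `M` at `w`.
  have key := Complex.dist_le_div_mul_dist_of_mapsTo_ball (f := fun t : ℂ => f (w + t • u))
    (c := 0) (R₁ := 1 / d) (R₂ := 4 * M) (z := ((‖z - w‖ : ℝ) : ℂ)) (hdiff w u).differentiableOn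
    (by
      intro t ht
      rw [mem_ball_zero_iff] at ht
      rw [Metric.mem_closedBall, dist_eq_norm]
      have h1 : ‖f (w + t • u)‖ ≤ 3 * M := by
        apply hbound
        refine (norm_add_le _ _).trans ?_
        rw [norm_smul, hu1]
        linarith
      have h2 : ‖f (w + (0 : ℂ) • u)‖ ≤ M := by
        apply hM; simpa using hw
      exact (norm_sub_le _ _).trans (by linarith))
    (by rw [mem_ball_zero_iff, Complex.norm_real, norm_norm]; exact hzw)
  simp only [hz, zero_smul, add_zero, dist_eq_norm, sub_zero, Complex.norm_real, norm_norm] at key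
  refine key.trans_eq ?_
  field_simp

/-! ### Homogeneous polynomials with random signs -/

/-- The homogeneous polynomial `∑ ε_α (d! / α!) z^α`, summed over `|α| = d`. -/
noncomputable def signPoly {n : ℕ} (d : ℕ) (ε : (Fin n → ℕ) → ℝ) (z : Fin n → ℂ) : ℂ :=
  ∑ α ∈ Finset.piAntidiag Finset.univ d,
    ((ε α : ℂ) * (Nat.multinomial Finset.univ α : ℂ)) * ∏ j, z j ^ α j

theorem prod_smul_pow {n d : ℕ} {α : Fin n → ℕ} (hα : α ∈ Finset.piAntidiag Finset.univ d)
    {R : Type*} [CommSemiring R] (c : R) (z : Fin n → R) :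
    ∏ j, (c * z j) ^ α j = c ^ d * ∏ j, z j ^ α j := by
  simp_rw [mul_pow]
  rw [Finset.prod_mul_distrib, Finset.prod_pow_eq_pow_sum]
  rw [(Finset.mem_piAntidiag.1 hα).1]

theorem signPoly_smul {n : ℕ} (d : ℕ) (ε : (Fin n → ℕ) → ℝ) (c : ℂ) (z : Fin n → ℂ) :
    signPoly d ε (fun j => c * z j) = c ^ d * signPoly d ε z := by
  unfold signPoly
  rw [Finset.mul_sum]
  refine Finset.sum_congr rfl fun α hα => ?_
  rw [prod_smul_pow hα]
  ring

theorem differentiable_signPoly {n : ℕ} (d : ℕ) (ε : (Fin n → ℕ) → ℝ) {g : ℂ → Fin n → ℂ}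
    (hg : ∀ j, Differentiable ℂ fun t => g t j) :
    Differentiable ℂ fun t => signPoly d ε (g t) := by
  unfold signPoly
  fun_prop

theorem continuous_signPoly {n : ℕ} (d : ℕ) (ε : (Fin n → ℕ) → ℝ) :
    Continuous fun z : Fin n → ℂ => signPoly d ε z := by
  unfold signPoly
  fun_prop

/-- By the multinomial theorem the right side is the sum of the moduli of the terms when the signs
are unimodular. It is the `ℓ_1` endpoint of the interpolation. -/
theorem norm_signPoly_le {n : ℕ} (d : ℕ) {ε : (Fin n → ℕ) → ℝ} (hε : ∀ α, |ε α| ≤ 1)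
    (z : Fin n → ℂ) : ‖signPoly d ε z‖ ≤ (∑ j, ‖z j‖) ^ d := by
  rw [Finset.sum_pow_eq_sum_piAntidiag]
  refine (norm_sum_le _ _).trans (Finset.sum_le_sum fun α _ => ?_)
  rw [norm_mul, norm_mul, Complex.norm_real, Complex.norm_natCast, norm_prod]
  simp_rw [norm_pow]
  have := hε α
  rw [Real.norm_eq_abs]
  calc |ε α| * (Nat.multinomial Finset.univ α : ℝ) * ∏ j, ‖z j‖ ^ α j
      ≤ 1 * (Nat.multinomial Finset.univ α : ℝ) * ∏ j, ‖z j‖ ^ α j := by gcongr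
    _ = _ := by ring

theorem multinomial_le_factorial {n d : ℕ} {α : Fin n → ℕ}
    (hα : α ∈ Finset.piAntidiag Finset.univ d) :
    Nat.multinomial Finset.univ α ≤ d.factorial := by
  unfold Nat.multinomial
  rw [(Finset.mem_piAntidiag.1 hα).1]
  exact Nat.div_le_self _ _

/-- This is the variance proxy for the random sum. One factor `d! / α!` is bounded by `d!`; the
other is kept as the weight in the expansion of `(∑ |z_j|²)^d`. -/
theorem sum_multinomial_sq_le {n d : ℕ} {z : Fin n → ℂ} (hz : ∑ j, ‖z j‖ ^ 2 ≤ 1) :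
    ∑ α ∈ Finset.piAntidiag Finset.univ d,
      ((Nat.multinomial Finset.univ α : ℝ) * (∏ j, z j ^ α j).re) ^ 2 ≤ d.factorial := by
  calc _ ≤ ∑ α ∈ Finset.piAntidiag Finset.univ d,
        (d.factorial : ℝ) * ((Nat.multinomial Finset.univ α : ℝ) * ∏ j, (‖z j‖ ^ 2) ^ α j) := by
        refine Finset.sum_le_sum fun α hα => ?_
        have h1 : (∏ j, z j ^ α j).re ^ 2 ≤ ∏ j, (‖z j‖ ^ 2) ^ α j := by
          have := Complex.abs_re_le_norm (∏ j, z j ^ α j)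
          calc _ = |(∏ j, z j ^ α j).re| ^ 2 := (sq_abs _).symm
            _ ≤ ‖∏ j, z j ^ α j‖ ^ 2 := by gcongr
            _ = _ := by
              rw [norm_prod, ← Finset.prod_pow]
              exact Finset.prod_congr rfl fun j _ => by rw [norm_pow]; ring
        have h2 : (Nat.multinomial Finset.univ α : ℝ) ≤ d.factorial := by
          exact_mod_cast multinomial_le_factorial hα
        rw [mul_pow, pow_two (Nat.multinomial Finset.univ α : ℝ), mul_assoc]
        gcongr
    _ = d.factorial * (∑ j, ‖z j‖ ^ 2) ^ d := by
        rw [Finset.sum_pow_eq_sum_piAntidiag, Finset.mul_sum]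
    _ ≤ d.factorial * 1 := by
        gcongr
        exact pow_le_one₀ (by positivity) hz
    _ = _ := mul_one _

theorem exists_norm_eq_one_pow_mul {d : ℕ} (hd : 0 < d) (a : ℂ) :
    ∃ c : ℂ, ‖c‖ = 1 ∧ c ^ d * a = ‖a‖ := by
  rcases eq_or_ne a 0 with rfl | ha
  · exact ⟨1, by simp⟩
  obtain ⟨c, hc⟩ := IsAlgClosed.exists_pow_nat_eq ((‖a‖ : ℂ) / a) hd
  have ha' : ‖a‖ ≠ 0 := norm_ne_zero_iff.2 ha
  refine ⟨c, ?_, by rw [hc]; field_simp⟩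
  have : ‖c‖ ^ d = 1 := by
    rw [← norm_pow, hc, norm_div, Complex.norm_real, norm_norm, div_self ha']
  exact (pow_eq_one_iff_of_nonneg (norm_nonneg _) hd.ne').1 this

theorem one_add_mul_le_exp {d : ℕ} (hd : 6 ≤ d) : (1 + 16 * d : ℝ) ≤ Real.exp d := by
  induction d, hd using Nat.le_induction with
  | base =>
    have h : (2.7 : ℝ) ≤ Real.exp 1 := by linarith [Real.exp_one_gt_d9]
    have : Real.exp ((6 : ℕ) : ℝ) = Real.exp 1 ^ 6 := by
      rw [← Real.exp_nat_mul]; norm_num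
    rw [this]
    calc (1 + 16 * ((6 : ℕ) : ℝ)) ≤ 2.7 ^ 6 := by norm_num
      _ ≤ _ := by gcongr
  | succ d hd ih =>
    push_cast
    rw [Real.exp_add]
    have h : (2 : ℝ) ≤ Real.exp 1 := by linarith [Real.exp_one_gt_d9]
    have hd' : (6 : ℝ) ≤ d := by exact_mod_cast hd
    nlinarith [Real.exp_pos (d : ℝ)]

/-- There are signs making the norm of `∑ ± (d! / α!) z^α` on the Euclidean unit ball small. -/
theorem exists_signPoly_le (n : ℕ) (hn : 0 < n) {d : ℕ} (hd : 6 ≤ d) :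
    ∃ ε : (Fin n → ℕ) → ℝ, (∀ α, |ε α| = 1) ∧
      ∀ z : Fin n → ℂ, ∑ j, ‖z j‖ ^ 2 ≤ 1 →
        ‖signPoly d ε z‖ ≤ Real.sqrt (16 * d * n * d.factorial) := by
  classical
  have hd0 : 0 < d := by omega
  have hdR : (0 : ℝ) < d := by exact_mod_cast hd0
  have hnR : (0 : ℝ) < n := by exact_mod_cast hn
  let E := EuclideanSpace ℂ (Fin n)
  have hnorm : ∀ z : E, ‖z‖ ≤ 1 ↔ ∑ j, ‖z j‖ ^ 2 ≤ 1 := fun z => by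
    rw [EuclideanSpace.norm_eq, Real.sqrt_le_one]
  -- With Lipschitz constant `4 d M`, the mesh `1 / (8 d)` loses only half of the maximum `M`.
  obtain ⟨s, hs1, hs2, hs3⟩ := exists_net_unit_ball E (δ := 1 / (8 * d)) (by positivity)
  have hrank : Module.finrank ℝ E = 2 * n := by
    rw [finrank_real_of_complex, finrank_euclideanSpace, Fintype.card_fin]
  have hcard : (s.card : ℝ) ≤ Real.exp (2 * n * d) := by
    refine hs3.trans ?_
    rw [hrank]
    have e : (1 + 2 / (1 / (8 * d)) : ℝ) = 1 + 16 * d := by field_simp; ring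
    rw [e]
    calc (1 + 16 * d : ℝ) ^ (2 * n) ≤ Real.exp d ^ (2 * n) := by
          gcongr; exact one_add_mul_le_exp hd
      _ = _ := by rw [← Real.exp_nat_mul]; push_cast; ring_nf
  obtain ⟨ε, hε1, hε2⟩ := exists_signs_sum_le
    (A := ↥(Finset.piAntidiag (Finset.univ : Finset (Fin n)) d)) s
    (fun t α => (Nat.multinomial Finset.univ α.1 : ℝ) * (∏ j, t j ^ α.1 j).re)
    (V := d.factorial) (B := 2 * n * d) (by exact_mod_cast d.factorial_pos) (by positivity)
    (fun t ht => by
      have := sum_multinomial_sq_le (d := d) ((hnorm t).1 (hs1 t ht))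
      rwa [← Finset.sum_coe_sort] at this) hcard
  let η : (Fin n → ℕ) → ℝ := fun α =>
    if h : α ∈ Finset.piAntidiag Finset.univ d then ε ⟨α, h⟩ else 1
  refine ⟨η, fun α => ?_, ?_⟩
  · by_cases h : α ∈ Finset.piAntidiag Finset.univ d
    · simp only [η, dif_pos h]
      rcases hε1 ⟨α, h⟩ with e | e <;> rw [e] <;> simp
    · simp only [η, dif_neg h, abs_one]
  have hre : ∀ t ∈ s, (signPoly d η t).re ≤ Real.sqrt (2 * d.factorial * (2 * n * d)) := by
    intro t ht
    refine le_trans (le_of_eq ?_) (hε2 t ht)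
    rw [signPoly, Complex.re_sum, ← Finset.sum_coe_sort]
    refine Finset.sum_congr rfl fun α _ => ?_
    have : η α.1 = ε α := by simp only [η, α.2, dif_pos]
    rw [this, mul_assoc, Complex.re_ofReal_mul, ← Complex.ofReal_natCast, Complex.re_ofReal_mul]
  let f : E → ℂ := fun z => signPoly d η z
  have hf : Continuous f := (continuous_signPoly d η).comp (PiLp.continuous_ofLp 2 _)
  obtain ⟨z₀, hz₀, hmax⟩ := (isCompact_closedBall (0 : E) 1).exists_isMaxOn
    ⟨0, by simp⟩ hf.norm.continuousOn
  have hz₀' : ‖z₀‖ ≤ 1 := by simpa using hz₀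
  have hM : ∀ z : E, ‖z‖ ≤ 1 → ‖f z‖ ≤ ‖f z₀‖ := fun z hz => hmax (by simpa using hz)
  -- Homogeneity lets a rotation make the value at the maximum point real and nonnegative, so
  -- one-sided bounds on real parts over the net suffice.
  obtain ⟨c, hc1, hc2⟩ := exists_norm_eq_one_pow_mul hd0 (f z₀)
  have hhom : ∀ (c : ℂ) (z : E), f (c • z) = c ^ d * f z := fun c z => signPoly_smul d η c z
  obtain ⟨t, ht, htz⟩ := hs2 (c • z₀) (by rw [norm_smul, hc1, one_mul]; exact hz₀')
  have hlip := norm_sub_le_of_homogeneous hd0 hhom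
    (fun w u => differentiable_signPoly d η (g := fun t j => w j + t * u j)
      (fun j => by fun_prop)) hM (w := t) (z := c • z₀) (hs1 t ht)
    (htz.trans_lt (by
      apply one_div_lt_one_div_of_lt hdR; linarith))
  rw [hhom, hc2] at hlip
  have h1 : ‖f z₀‖ - (f t).re ≤ ‖f z₀‖ / 2 := by
    calc ‖f z₀‖ - (f t).re = ((‖f z₀‖ : ℂ) - f t).re := by simp
      _ ≤ ‖(‖f z₀‖ : ℂ) - f t‖ := Complex.re_le_norm _
      _ ≤ 4 * d * ‖f z₀‖ * ‖c • z₀ - t‖ := hlip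
      _ ≤ 4 * d * ‖f z₀‖ * (1 / (8 * d)) := by gcongr
      _ = ‖f z₀‖ / 2 := by field_simp; ring
  have h2 : ‖f z₀‖ ≤ Real.sqrt (16 * d * n * d.factorial) := by
    have e : Real.sqrt (16 * d * n * d.factorial) =
        2 * Real.sqrt (2 * d.factorial * (2 * n * d)) := by
      rw [show (16 * d * n * d.factorial : ℝ) = 2 ^ 2 * (2 * d.factorial * (2 * n * d)) by ring,
        Real.sqrt_mul (by norm_num), Real.sqrt_sq (by norm_num)]
    have := hre t ht
    change (f t).re ≤ _ at this
    linarith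
  intro z hz
  exact (hM (WithLp.toLp 2 z) ((hnorm _).2 hz)).trans h2

/-! ### Complex interpolation between `ℓ_1` and `ℓ_2` -/

theorem norm_mul_exp_log {z : ℂ} (hz : z ≠ 0) (a : ℂ) :
    ‖z * Complex.exp ((a - 1) * (Real.log ‖z‖ : ℝ))‖ = ‖z‖ ^ a.re := by
  have h : 0 < ‖z‖ := norm_pos_iff.2 hz
  rw [norm_mul, Complex.norm_exp, Complex.re_mul_ofReal, Complex.sub_re, Complex.one_re,
    Real.rpow_def_of_pos h]
  nth_rewrite 1 [← Real.exp_log h]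
  rw [← Real.exp_add]
  ring_nf

/-- Interpolation of the bounds on the unit balls of `ℓ_1` and `ℓ_2`. -/
theorem norm_signPoly_interp {n d : ℕ} {ε : (Fin n → ℕ) → ℝ} (hε : ∀ α, |ε α| ≤ 1) {M : ℝ}
    (hM : ∀ z : Fin n → ℂ, ∑ j, ‖z j‖ ^ 2 ≤ 1 → ‖signPoly d ε z‖ ≤ M) {q : ℝ} (hq1 : 1 ≤ q)
    (hq2 : q ≤ 2) {z : Fin n → ℂ} (hz : ∑ j, ‖z j‖ ^ q ≤ 1) :
    ‖signPoly d ε z‖ ≤ M ^ (2 * (1 - 1 / q)) := by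
  have hq0 : 0 < q := by linarith
  have hz1 : ∀ j, ‖z j‖ ≤ 1 := by
    intro j
    have h1 : ‖z j‖ ^ q ≤ 1 := (Finset.single_le_sum (f := fun j => ‖z j‖ ^ q)
      (fun _ _ => by positivity) (Finset.mem_univ j)).trans hz
    by_contra! h
    exact absurd h1 (not_le.2 (Real.one_lt_rpow h hq0))
  -- Analytic family with `|g s j| = |z_j|^{q (1 - Re s / 2)}` for `z_j ≠ 0`: it lies in the `ℓ_1`
  -- ball on `Re s = 0`, in the `ℓ_2` ball on `Re s = 1`, and equals `z` at `s = 2 (1 - 1 / q)`.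
  let g : ℂ → Fin n → ℂ := fun s j =>
    z j * Complex.exp (((q : ℂ) * (1 - s / 2) - 1) * (Real.log ‖z j‖ : ℝ))
  have hg0 : ∀ s j, z j = 0 → g s j = 0 := fun s j h => by simp [g, h]
  have hgn : ∀ s j, z j ≠ 0 → ‖g s j‖ = ‖z j‖ ^ (q * (1 - s.re / 2)) := fun s j h => by
    simp only [g]
    rw [norm_mul_exp_log h, Complex.re_ofReal_mul]
    simp
  have hgd : Differentiable ℂ fun s => signPoly d ε (g s) :=
    differentiable_signPoly d ε fun j => by simp only [g]; fun_prop
  have hθ0 : 0 ≤ 2 * (1 - 1 / q) := by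
    have : 1 / q ≤ 1 := by rw [div_le_one hq0]; exact hq1
    linarith
  have hθ1 : 2 * (1 - 1 / q) ≤ 1 := by
    have : 1 / 2 ≤ 1 / q := one_div_le_one_div_of_le hq0 hq2
    linarith
  have key := Complex.HadamardThreeLines.norm_le_interp_of_mem_verticalClosedStrip₀₁'
    (fun s => signPoly d ε (g s)) (z := ((2 * (1 - 1 / q) : ℝ) : ℂ)) (a := 1) (b := M)
    (by
      rw [Complex.HadamardThreeLines.verticalClosedStrip, Set.mem_preimage, Complex.ofReal_re]
      exact ⟨hθ0, hθ1⟩)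
    hgd.diffContOnCl
    (by
      refine ⟨(n : ℝ) ^ d, ?_⟩
      rintro _ ⟨s, hs, rfl⟩
      have hs' : 0 ≤ s.re ∧ s.re ≤ 1 := hs
      refine (norm_signPoly_le d hε (g s)).trans ?_
      have : ∑ j, ‖g s j‖ ≤ n := by
        calc ∑ j, ‖g s j‖ ≤ ∑ _j : Fin n, (1 : ℝ) := by
              refine Finset.sum_le_sum fun j _ => ?_
              by_cases h : z j = 0
              · rw [hg0 s j h]; simp
              · rw [hgn s j h]
                apply Real.rpow_le_one (norm_nonneg _) (hz1 j)
                apply mul_nonneg hq0.le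
                linarith [hs'.2]
          _ = n := by simp
      gcongr)
    (by
      intro s hs
      have hs' : s.re = 0 := hs
      refine (norm_signPoly_le d hε (g s)).trans (pow_le_one₀ (by positivity) ?_)
      refine le_trans (Finset.sum_le_sum fun j _ => ?_) hz
      by_cases h : z j = 0
      · rw [hg0 s j h, h]; simp [Real.zero_rpow hq0.ne']
      · rw [hgn s j h, hs']; simp)
    (by
      intro s hs
      have hs' : s.re = 1 := hs
      apply hM
      refine le_trans (Finset.sum_le_sum fun j _ => ?_) hz
      by_cases h : z j = 0
      · rw [hg0 s j h, h]; simp [Real.zero_rpow hq0.ne']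
      · rw [hgn s j h, hs', ← Real.rpow_natCast, ← Real.rpow_mul (norm_nonneg _)]
        apply le_of_eq
        congr 1
        push_cast
        ring)
  have hgz : g ((2 * (1 - 1 / q) : ℝ) : ℂ) = z := by
    funext j
    have hqC : (q : ℂ) ≠ 0 := by exact_mod_cast hq0.ne'
    have : (q : ℂ) * (1 - ((2 * (1 - 1 / q) : ℝ) : ℂ) / 2) - 1 = 0 := by
      push_cast; field_simp; ring
    simp only [g, this, zero_mul, Complex.exp_zero, mul_one]
  simpa only [hgz, Real.one_rpow, one_mul, Complex.ofReal_re] using key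

/-! ### Geometry of `ℓ_p` balls and testing radii -/

theorem mem_lpUnitBall_iff {n : ℕ} {p : ℝ≥0∞} (hp : 1 ≤ p) (hp' : p ≠ ∞) {z : Fin n → ℂ} :
    z ∈ lpUnitBall p n ↔ ∑ j, ‖z j‖ ^ p.toReal < 1 := by
  have hq : 0 < p.toReal := ENNReal.toReal_pos (by positivity) hp'
  have h0 : 0 ≤ ∑ j, ‖z j‖ ^ p.toReal := by positivity
  unfold lpUnitBall
  rw [Set.mem_ofPred_eq, PiLp.norm_eq_sum hq]
  constructor
  · intro h
    by_contra! h'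
    exact absurd h (not_lt.2 (Real.one_le_rpow h' (by positivity)))
  · intro h
    exact Real.rpow_lt_one h0 h (by positivity)

theorem norm_lt_one_of_mem_lpUnitBall {n : ℕ} {p : ℝ≥0∞} (hp : 1 ≤ p) {z : Fin n → ℂ}
    (hz : z ∈ lpUnitBall p n) (j : Fin n) : ‖z j‖ < 1 := by
  have : Fact (1 ≤ p) := ⟨hp⟩
  exact (PiLp.norm_apply_le (WithLp.toLp p z : PiLp p (fun _ : Fin n => ℂ)) j).trans_lt hz

/-- The power mean inequality. -/
theorem sum_le_card_rpow_mul {n : ℕ} {a : Fin n → ℝ} (ha : ∀ j, 0 ≤ a j) {s : ℝ} (hs : 1 ≤ s) :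
    ∑ j, a j ≤ (n : ℝ) ^ (1 - 1 / s) * (∑ j, a j ^ s) ^ (1 / s) := by
  have hs0 : 0 < s := by linarith
  have h := Real.rpow_sum_le_const_mul_sum_rpow (Finset.univ : Finset (Fin n)) a hs
  simp_rw [abs_of_nonneg (ha _)] at h
  rw [Finset.card_univ, Fintype.card_fin] at h
  have h0 : 0 ≤ ∑ j, a j := Finset.sum_nonneg fun j _ => ha j
  have h1 : 0 ≤ ∑ j, a j ^ s := Finset.sum_nonneg fun j _ => Real.rpow_nonneg (ha j) _
  have h2 := Real.rpow_le_rpow (by positivity) h (by positivity : (0 : ℝ) ≤ 1 / s)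
  rw [← Real.rpow_mul h0, Real.mul_rpow (by positivity) h1, ← Real.rpow_mul (by positivity),
    mul_one_div_cancel hs0.ne', Real.rpow_one] at h2
  have e : (s - 1) * (1 / s) = 1 - 1 / s := by field_simp
  rwa [e] at h2

/-- The square of the Euclidean norm on the unit ball of `ℓ_p`, for `p ≥ 2`. -/
theorem sum_sq_le_of_mem_lpUnitBall {n : ℕ} {p : ℝ≥0∞} (hp : 2 ≤ p)
    {z : Fin n → ℂ} (hz : z ∈ lpUnitBall p n) :
    ∑ j, ‖z j‖ ^ 2 ≤ (n : ℝ) ^ (1 - 2 / p.toReal) := by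
  have hp1 : 1 ≤ p := le_trans (by norm_num) hp
  rcases eq_or_ne p ∞ with rfl | hp'
  · calc ∑ j, ‖z j‖ ^ 2 ≤ ∑ _j : Fin n, (1 : ℝ) := by
          refine Finset.sum_le_sum fun j _ => pow_le_one₀ (norm_nonneg _) ?_
          exact (norm_lt_one_of_mem_lpUnitBall hp1 hz j).le
      _ = _ := by simp
  · have hq2 : 2 ≤ p.toReal := by
      have := ENNReal.toReal_mono hp' hp
      simpa using this
    have h := (mem_lpUnitBall_iff hp1 hp').1 hz
    have h1 := sum_le_card_rpow_mul (a := fun j => ‖z j‖ ^ 2) (fun j => by positivity)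
      (s := p.toReal / 2) (by linarith)
    have e : ∀ j, (‖z j‖ ^ 2) ^ (p.toReal / 2) = ‖z j‖ ^ p.toReal := fun j => by
      rw [← Real.rpow_natCast, ← Real.rpow_mul (norm_nonneg _)]
      congr 1
      push_cast
      ring
    simp_rw [e] at h1
    rw [one_div_div] at h1
    refine h1.trans (mul_le_of_le_one_right (by positivity) ?_)
    exact Real.rpow_le_one (by positivity) h.le (by positivity)

/-- Testing an admissible radius with a polynomial with random signs. -/
theorem mul_sum_pow_le_of_mem_bohrRadii {n d : ℕ} {G : Set (Fin n → ℂ)} {r : ℝ}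
    (hr : r ∈ bohrRadii G) {ε : (Fin n → ℕ) → ℝ} (hε : ∀ α, |ε α| = 1) {M : ℝ} (hM0 : 0 < M)
    (hM : ∀ z ∈ G, ‖signPoly d ε z‖ ≤ M) {w : Fin n → ℂ} (hw : w ∈ G) :
    (r * ∑ j, ‖w j‖) ^ d ≤ M := by
  classical
  let c : (Fin n → ℕ) → ℂ := fun α => if α ∈ Finset.piAntidiag Finset.univ d then
    ((ε α : ℂ) * (Nat.multinomial Finset.univ α : ℂ)) / M else 0
  have hc0 : ∀ z α, α ∉ Finset.piAntidiag Finset.univ d → psTerm c z α = 0 := by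
    intro z α h
    simp only [psTerm, c, if_neg h, zero_mul]
  have hc1 : ∀ z α, α ∈ Finset.piAntidiag Finset.univ d → psTerm c z α =
      ((ε α : ℂ) * (Nat.multinomial Finset.univ α : ℂ)) * (∏ j, z j ^ α j) / M := by
    intro z α h
    simp only [psTerm, c, if_pos h]
    ring
  have hS : SumBoundedOn c G := by
    intro z hz
    refine ⟨summable_of_ne_finset_zero fun α h => hc0 z α h, ?_⟩
    rw [tsum_eq_sum fun α h => hc0 z α h, Finset.sum_congr rfl fun α h => hc1 z α h,
      ← Finset.sum_div, norm_div, Complex.norm_real, Real.norm_of_nonneg hM0.le, div_le_one hM0]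
    exact hM z hz
  have h := (hr.2 c hS (r • w) (Set.smul_mem_smul_set hw)).2
  rw [tsum_eq_sum fun α h => by rw [hc0 _ α h, norm_zero]] at h
  have e : ∀ α ∈ Finset.piAntidiag Finset.univ d, ‖psTerm c (r • w) α‖ =
      ((Nat.multinomial Finset.univ α : ℝ) * ∏ j, (r * ‖w j‖) ^ α j) / M := by
    intro α hα
    rw [hc1 _ α hα, norm_div, norm_mul, norm_mul, Complex.norm_real, Real.norm_eq_abs, hε, one_mul,
      Complex.norm_natCast, norm_prod, Complex.norm_real, Real.norm_of_nonneg hM0.le]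
    congr 2
    refine Finset.prod_congr rfl fun j _ => ?_
    rw [norm_pow, Pi.smul_apply, norm_smul, Real.norm_of_nonneg hr.1]
  rw [Finset.sum_congr rfl e, ← Finset.sum_div, ← Finset.sum_pow_eq_sum_piAntidiag,
    ← Finset.mul_sum, div_le_one hM0] at h
  exact h

/-- Diagonal points are the ones where `∑ |w_j|` approaches its supremum on the ball. At `p = ∞`,
`p.toReal = 0` and `1 / 0 = 0` give the correct power `n^0`. -/
theorem const_mem_lpUnitBall {n : ℕ} (hn : 0 < n) {p : ℝ≥0∞} (hp : 1 ≤ p) {t : ℝ} (ht0 : 0 ≤ t)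
    (ht1 : t < 1) : (fun _ => ((t / (n : ℝ) ^ (1 / p.toReal) : ℝ) : ℂ)) ∈ lpUnitBall p n := by
  have : Nonempty (Fin n) := ⟨⟨0, hn⟩⟩
  have : Fact (1 ≤ p) := ⟨hp⟩
  have hnR : (0 : ℝ) < n := by exact_mod_cast hn
  have h := PiLp.norm_toLp_const' (p := p) (ι := Fin n)
    ((t / (n : ℝ) ^ (1 / p.toReal) : ℝ) : ℂ)
  unfold lpUnitBall
  rw [Set.mem_ofPred_eq]
  refine lt_of_eq_of_lt h ?_
  rw [Complex.norm_real, Real.norm_of_nonneg (by positivity)]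
  simp only [Fintype.card_fin, NNReal.coe_natCast,
    ENNReal.toReal_div, ENNReal.toReal_one]
  rw [mul_div_cancel₀ _ (by positivity)]
  exact ht1

/-- The bound on admissible radii of `ℓ_p` balls provided by a polynomial with random signs. -/
theorem mul_rpow_pow_le_of_mem_bohrRadii {n d : ℕ} (hn : 0 < n) {p : ℝ≥0∞} (hp : 1 ≤ p) {r : ℝ}
    (hr : r ∈ bohrRadii (lpUnitBall p n)) {ε : (Fin n → ℕ) → ℝ} (hε : ∀ α, |ε α| = 1) {M : ℝ}
    (hM0 : 0 < M) (hM : ∀ z ∈ lpUnitBall p n, ‖signPoly d ε z‖ ≤ M) :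
    (r * (n : ℝ) ^ (1 - 1 / p.toReal)) ^ d ≤ M := by
  have hnR : (0 : ℝ) < n := by exact_mod_cast hn
  have h : ∀ t : ℝ, 0 ≤ t → t < 1 → (r * (n : ℝ) ^ (1 - 1 / p.toReal) * t) ^ d ≤ M := by
    intro t ht0 ht1
    have h := mul_sum_pow_le_of_mem_bohrRadii hr hε hM0 hM (const_mem_lpUnitBall hn hp ht0 ht1)
    rw [Finset.sum_const, Finset.card_univ, Fintype.card_fin, Complex.norm_real,
      Real.norm_of_nonneg (by positivity), nsmul_eq_mul] at h
    rw [Real.rpow_sub hnR, Real.rpow_one]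
    convert h using 2
    ring
  have hlim : Filter.Tendsto (fun t : ℝ => (r * (n : ℝ) ^ (1 - 1 / p.toReal) * t) ^ d)
      (nhdsWithin 1 (Set.Iio 1)) (nhds ((r * (n : ℝ) ^ (1 - 1 / p.toReal) * 1) ^ d)) :=
    (Continuous.tendsto (by fun_prop) 1).mono_left nhdsWithin_le_nhds
  rw [mul_one] at hlim
  refine le_of_tendsto hlim ?_
  filter_upwards [Ioo_mem_nhdsLT (zero_lt_one (α := ℝ))] with t ht
  exact h t ht.1.le ht.2

/-! ### Choice of the degree -/

/-- For `d = ⌈log n⌉` one has `n ≤ e^d` and `d - 1 ≤ log n`, which removes `n`. In the induction the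
left side grows by `e (d + 1)² / d`, the right by at least `8 d`. -/
theorem mul_factorial_lt_pow {d : ℕ} (hd : 6 ≤ d) :
    16 * d * (d.factorial : ℝ) * Real.exp 1 ^ d < (4 * (d - 1)) ^ d := by
  induction d, hd using Nat.le_induction with
  | base =>
    have h : Real.exp 1 ≤ 2.72 := by linarith [Real.exp_one_lt_d9]
    calc 16 * ((6 : ℕ) : ℝ) * (Nat.factorial 6 : ℝ) * Real.exp 1 ^ 6
        ≤ 16 * ((6 : ℕ) : ℝ) * (Nat.factorial 6 : ℝ) * 2.72 ^ 6 := by gcongr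
      _ < _ := by norm_num [Nat.factorial]
  | succ d hd ih =>
    have hd' : (6 : ℝ) ≤ d := by exact_mod_cast hd
    have h : Real.exp 1 ≤ 2.72 := by linarith [Real.exp_one_lt_d9]
    have hb : (2 : ℝ) * (d - 1) ^ d ≤ d ^ d := by
      have h1 : (0 : ℝ) < d - 1 := by linarith
      have h2 := one_add_mul_le_pow (a := (1 / (d - 1) : ℝ))
        (by have : (0 : ℝ) < 1 / (d - 1) := by positivity
            linarith) d
      have h3 : (2 : ℝ) ≤ (1 + 1 / (d - 1)) ^ d := by
        refine le_trans ?_ h2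
        have : (1 : ℝ) ≤ d * (1 / (d - 1)) := by
          rw [mul_one_div, one_le_div h1]; linarith
        linarith
      have h4 : (d : ℝ) = (1 + 1 / (d - 1)) * (d - 1) := by field_simp; ring
      calc (2 : ℝ) * (d - 1) ^ d ≤ (1 + 1 / (d - 1)) ^ d * (d - 1) ^ d := by gcongr
        _ = d ^ d := by rw [← mul_pow, ← h4]
    rw [Nat.factorial_succ]
    push_cast
    rw [add_sub_cancel_right]
    have h5 : (4 * (d - 1) : ℝ) ^ d * (8 * d) ≤ (4 * d) ^ (d + 1) := by
      calc (4 * (d - 1) : ℝ) ^ d * (8 * d) = 4 ^ d * (4 * d) * (2 * (d - 1) ^ d) := by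
            rw [mul_pow]; ring
        _ ≤ 4 ^ d * (4 * d) * d ^ d := by gcongr
        _ = _ := by rw [mul_pow, pow_succ, pow_succ]; ring
    refine lt_of_lt_of_le ?_ h5
    have h6 : 16 * ((d : ℝ) + 1) * ((d + 1) * d.factorial) * Real.exp 1 ^ (d + 1) =
        (16 * d * (d.factorial : ℝ) * Real.exp 1 ^ d) * ((d + 1) ^ 2 / d * Real.exp 1) := by
      rw [pow_succ]; field_simp
    rw [h6]
    have h7 : ((d : ℝ) + 1) ^ 2 / d * Real.exp 1 ≤ (8 : ℝ) * d := by
      calc ((d : ℝ) + 1) ^ 2 / d * Real.exp 1 ≤ ((d : ℝ) + 1) ^ 2 / d * 2.72 := by gcongr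
        _ ≤ (8 : ℝ) * d := by
          rw [div_mul_eq_mul_div, div_le_iff₀ (by linarith)]
          nlinarith
    exact mul_lt_mul ih h7 (by positivity) (by
      have : (0 : ℝ) ≤ 4 * (d - 1) := by linarith
      positivity)

/-- The degree used for large `n`. -/
theorem exists_degree {n : ℕ} (hn : 5 < Real.log n) :
    ∃ d : ℕ, 6 ≤ d ∧ 16 * d * n * (d.factorial : ℝ) < (4 * Real.log n) ^ d := by
  have hn0 : (0 : ℝ) < n := by
    rcases Nat.eq_zero_or_pos n with rfl | h
    · norm_num at hn
    · exact_mod_cast h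
  have h5 : 5 < ⌈Real.log n⌉₊ := Nat.lt_ceil.2 (by exact_mod_cast hn)
  refine ⟨⌈Real.log n⌉₊, h5, ?_⟩
  set d := ⌈Real.log n⌉₊ with hd
  have hd1 : Real.log n ≤ d := Nat.le_ceil _
  have hd2 : (d : ℝ) - 1 ≤ Real.log n := by
    linarith [Nat.ceil_lt_add_one (show 0 ≤ Real.log n by linarith)]
  have h6 : (6 : ℝ) ≤ d := by exact_mod_cast h5
  have hne : (n : ℝ) ≤ Real.exp 1 ^ d := by
    rw [← Real.exp_nat_mul, mul_one, ← Real.log_le_iff_le_exp hn0]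
    exact hd1
  calc 16 * d * n * (d.factorial : ℝ) = 16 * d * (d.factorial : ℝ) * n := by ring
    _ ≤ 16 * d * (d.factorial : ℝ) * Real.exp 1 ^ d := by gcongr
    _ < (4 * (d - 1)) ^ d := mul_factorial_lt_pow h5
    _ ≤ _ := by
      have : (0 : ℝ) ≤ 4 * (d - 1) := by linarith
      gcongr

/-! ### One-variable bound from Möbius transformations -/

theorem HasSum.of_eq {ι R : Type*} [AddCommMonoid R] [TopologicalSpace R] {f g : ι → R} {a : R}
    (h : HasSum f a) (e : ∀ i, g i = f i) : HasSum g a := by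
  rwa [funext e]

/-- The squares of the two sides differ by `(1 - a²) (1 - |ζ|²)`. -/
theorem norm_sub_le_norm_one_sub_mul {a : ℝ} (ha0 : 0 ≤ a) (ha1 : a ≤ 1) {ζ : ℂ} (hζ : ‖ζ‖ ≤ 1) :
    ‖(a : ℂ) - ζ‖ ≤ ‖1 - (a : ℂ) * ζ‖ := by
  have h : ζ.re ^ 2 + ζ.im ^ 2 ≤ 1 := by
    have : ‖ζ‖ ^ 2 ≤ 1 := pow_le_one₀ (norm_nonneg _) hζ
    rw [Complex.sq_norm, Complex.normSq_apply] at this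
    linarith
  rw [← abs_of_nonneg (norm_nonneg ((a : ℂ) - ζ)), ← abs_of_nonneg (norm_nonneg (1 - (a : ℂ) * ζ)),
    ← sq_le_sq, Complex.sq_norm, Complex.sq_norm, Complex.normSq_apply, Complex.normSq_apply]
  simp only [Complex.sub_re, Complex.sub_im, Complex.mul_re, Complex.mul_im, Complex.ofReal_re,
    Complex.ofReal_im, Complex.one_re, Complex.one_im]
  nlinarith [mul_nonneg (show 0 ≤ 1 - a ^ 2 by nlinarith)
    (show 0 ≤ 1 - (ζ.re ^ 2 + ζ.im ^ 2) by linarith)]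

/-- The Taylor coefficients of `(a - ζ) / (1 - a ζ)`. -/
noncomputable def moebiusCoeff (a : ℝ) (k : ℕ) : ℝ :=
  if k = 0 then a else -((1 - a ^ 2) * a ^ (k - 1))

theorem hasSum_moebius {a : ℝ} (ha0 : 0 ≤ a) (ha1 : a < 1) {ζ : ℂ} (hζ : ‖ζ‖ < 1) :
    HasSum (fun k => (moebiusCoeff a k : ℂ) * ζ ^ k) (((a : ℂ) - ζ) / (1 - a * ζ)) := by
  have h1 : ‖(a : ℂ) * ζ‖ < 1 := by
    rw [norm_mul, Complex.norm_real, Real.norm_of_nonneg ha0]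
    nlinarith [norm_nonneg ζ]
  have h0 : (1 - (a : ℂ) * ζ) ≠ 0 := by
    intro h
    have : (a : ℂ) * ζ = 1 := by linear_combination -h
    rw [this] at h1
    simp at h1
  have h2 := ((hasSum_geometric_of_norm_lt_one h1).mul_left (-(1 - (a : ℂ) ^ 2) * ζ))
  have h3 : HasSum (fun k => (moebiusCoeff a (k + 1) : ℂ) * ζ ^ (k + 1))
      (-(1 - (a : ℂ) ^ 2) * ζ * (1 - (a : ℂ) * ζ)⁻¹) := by
    refine h2.of_eq fun k => ?_
    simp only [moebiusCoeff, Nat.add_sub_cancel, if_neg (Nat.succ_ne_zero k)]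
    push_cast
    rw [mul_pow]
    ring
  have h4 := HasSum.zero_add (f := fun k => (moebiusCoeff a k : ℂ) * ζ ^ k) h3
  convert h4 using 1
  simp only [moebiusCoeff, if_true, pow_zero, mul_one]
  field_simp
  ring

theorem hasSum_abs_moebius {a : ℝ} (ha0 : 0 ≤ a) (ha1 : a < 1) {ρ : ℝ} (hρ0 : 0 ≤ ρ)
    (hρ : ρ < 1) :
    HasSum (fun k => |moebiusCoeff a k| * ρ ^ k) (a + (1 - a ^ 2) * ρ * (1 - a * ρ)⁻¹) := by
  have h1 : a * ρ < 1 := by nlinarith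
  have h2 := ((hasSum_geometric_of_lt_one (by positivity) h1).mul_left ((1 - a ^ 2) * ρ))
  have h3 : HasSum (fun k => |moebiusCoeff a (k + 1)| * ρ ^ (k + 1))
      ((1 - a ^ 2) * ρ * (1 - a * ρ)⁻¹) := by
    refine h2.of_eq fun k => ?_
    have : 0 ≤ (1 - a ^ 2) * a ^ k := mul_nonneg (by nlinarith) (by positivity)
    simp only [moebiusCoeff, Nat.add_sub_cancel, if_neg (Nat.succ_ne_zero k), abs_neg,
      abs_of_nonneg this]
    rw [mul_pow]
    ring
  have h4 := HasSum.zero_add (f := fun k => |moebiusCoeff a k| * ρ ^ k) h3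
  simpa only [moebiusCoeff, if_true, pow_zero, mul_one, abs_of_nonneg ha0] using h4

theorem single_mem_lpUnitBall {n : ℕ} {p : ℝ≥0∞} (hp : 1 ≤ p) (i : Fin n) {ζ : ℂ}
    (hζ : ‖ζ‖ < 1) : Pi.single i ζ ∈ lpUnitBall p n := by
  have : Fact (1 ≤ p) := ⟨hp⟩
  unfold lpUnitBall
  rw [Set.mem_ofPred_eq]
  exact (PiLp.norm_single p (fun _ : Fin n => ℂ) i ζ).trans_lt hζ

/-- The one-variable bound on the Bohr radius provided by a Möbius transformation. -/
theorem le_of_mem_bohrRadii_lpUnitBall {n : ℕ} (hn : 0 < n) {p : ℝ≥0∞} (hp : 1 ≤ p) {r : ℝ}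
    (hr : r ∈ bohrRadii (lpUnitBall p n)) {a : ℝ} (ha0 : 0 < a) (ha1 : a < 1) :
    r ≤ 1 / (1 + 2 * a) := by
  classical
  by_contra! hlt
  let i : Fin n := ⟨0, hn⟩
  let g : ℕ → (Fin n → ℕ) := fun k => Pi.single i k
  have hg : Function.Injective g := fun k l h => by
    have := congrFun h i
    simpa [g] using this
  let c : (Fin n → ℕ) → ℂ := fun α => if α ∈ Set.range g then (moebiusCoeff a (α i) : ℂ) else 0
  have hc0 : ∀ z α, α ∉ Set.range g → psTerm c z α = 0 := by
    intro z α h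
    simp only [psTerm, c, if_neg h, zero_mul]
  have hc1 : ∀ z k, psTerm c z (g k) = (moebiusCoeff a k : ℂ) * z i ^ k := by
    intro z k
    have h1 : g k ∈ Set.range g := ⟨k, rfl⟩
    have h2 : ∏ j, z j ^ (g k) j = z i ^ k := by
      rw [Finset.prod_eq_single i]
      · simp [g]
      · intro j _ hj
        simp [g, Pi.single_eq_of_ne hj]
      · simp
    simp only [psTerm, c, if_pos h1, h2]
    simp [g]
  have hS : SumBoundedOn c (lpUnitBall p n) := by
    intro z hz
    have hzi := norm_lt_one_of_mem_lpUnitBall hp hz i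
    have h : HasSum (psTerm c z) (((a : ℂ) - z i) / (1 - a * z i)) := by
      rw [← hg.hasSum_iff (fun α h => hc0 z α h)]
      have := hasSum_moebius ha0.le ha1 hzi
      simpa only [Function.comp_def, hc1] using this
    refine ⟨h.summable, ?_⟩
    rw [h.tsum_eq, norm_div]
    exact div_le_one_of_le₀ (norm_sub_le_norm_one_sub_mul ha0.le ha1.le hzi.le) (norm_nonneg _)
  have h13 : 1 / (1 + 2 * a) < 1 := by
    rw [div_lt_one (by positivity)]; linarith
  -- The majorant at `ρ e_i` is `a + (1 - a²) ρ / (1 - a ρ)`, which exceeds `1` as soon as `ρ > 1 /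
  -- (1 + 2 a)`.
  obtain ⟨ρ, hρ1, hρ2⟩ := exists_between (lt_min hlt h13)
  have hρr := hρ2.trans_le (min_le_left _ _)
  have hρ3 := hρ2.trans_le (min_le_right _ _)
  have hρ0 : 0 < ρ := lt_trans (by positivity) hρ1
  have hr0 : 0 < r := hρ0.trans hρr
  have hmem : (Pi.single i (ρ : ℂ) : Fin n → ℂ) ∈ r • lpUnitBall p n := by
    refine ⟨Pi.single i ((ρ / r : ℝ) : ℂ), single_mem_lpUnitBall hp i ?_, ?_⟩
    · rw [Complex.norm_real, Real.norm_of_nonneg (by positivity), div_lt_one hr0]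
      exact hρr
    · change r • _ = _
      rw [← Pi.single_smul, Complex.real_smul, ← Complex.ofReal_mul, mul_div_cancel₀ _ hr0.ne']
  have h := (hr.2 c hS _ hmem).2
  have hs : HasSum (fun α => ‖psTerm c (Pi.single i (ρ : ℂ)) α‖)
      (a + (1 - a ^ 2) * ρ * (1 - a * ρ)⁻¹) := by
    rw [← hg.hasSum_iff (fun α h => by rw [hc0 _ α h, norm_zero])]
    have := hasSum_abs_moebius ha0.le ha1 hρ0.le hρ3
    refine this.of_eq fun k => ?_
    rw [Function.comp_apply, hc1, norm_mul, norm_pow, Complex.norm_real, Real.norm_eq_abs,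
      Pi.single_eq_same, Complex.norm_real, Real.norm_of_nonneg hρ0.le]
  rw [hs.tsum_eq] at h
  have h1 : 0 < 1 - a * ρ := by nlinarith
  have h2 : (1 - a ^ 2) * ρ * (1 - a * ρ)⁻¹ ≤ 1 - a := by linarith
  rw [← div_eq_mul_inv, div_le_iff₀ h1] at h2
  rw [div_lt_iff₀ (by positivity)] at hρ1
  have h3 : (1 + a) * ρ ≤ 1 - a * ρ := by
    have h4 : (1 - a) * ((1 + a) * ρ) ≤ (1 - a) * (1 - a * ρ) := by linarith
    exact le_of_mul_le_mul_left h4 (by linarith)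
  linarith

/-! ### The supremum of admissible radii is attained -/

theorem zero_mem_lpUnitBall {n : ℕ} {p : ℝ≥0∞} (hp : 1 ≤ p) : (0 : Fin n → ℂ) ∈ lpUnitBall p n := by
  have : Fact (1 ≤ p) := ⟨hp⟩
  unfold lpUnitBall
  rw [Set.mem_ofPred_eq, WithLp.toLp_zero, norm_zero]
  exact zero_lt_one

theorem norm_toLp_smul {n : ℕ} {p : ℝ≥0∞} (hp : 1 ≤ p) (t : ℝ) (z : Fin n → ℂ) :
    ‖(WithLp.toLp p (t • z) : PiLp p (fun _ : Fin n => ℂ))‖ =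
      |t| * ‖(WithLp.toLp p z : PiLp p (fun _ : Fin n => ℂ))‖ := by
  have : Fact (1 ≤ p) := ⟨hp⟩
  rw [WithLp.toLp_smul, norm_smul, Real.norm_eq_abs]

theorem smul_lpUnitBall_subset {n : ℕ} {p : ℝ≥0∞} (hp : 1 ≤ p) {r s : ℝ} (hr : 0 ≤ r)
    (hrs : r ≤ s) : r • lpUnitBall p n ⊆ s • lpUnitBall p n := by
  have : Fact (1 ≤ p) := ⟨hp⟩
  rintro _ ⟨z, hz, rfl⟩
  rcases hr.eq_or_lt with rfl | hr0
  · exact ⟨0, zero_mem_lpUnitBall hp, by simp⟩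
  have hs0 : 0 < s := hr0.trans_le hrs
  refine ⟨(r / s) • z, ?_, ?_⟩
  · unfold lpUnitBall at hz ⊢
    rw [Set.mem_ofPred_eq] at hz ⊢
    rw [norm_toLp_smul hp, abs_of_nonneg (by positivity)]
    have : r / s ≤ 1 := (div_le_one hs0).2 hrs
    exact (mul_le_of_le_one_left (norm_nonneg _) this).trans_lt hz
  · change s • (r / s) • z = r • z
    rw [smul_smul, mul_div_cancel₀ _ hs0.ne']

/-- The set of admissible radii of an `ℓ_p` ball has a largest element. -/
theorem isGreatest_bohrRadius_lpUnitBall {n : ℕ} (hn : 0 < n) {p : ℝ≥0∞} (hp : 1 ≤ p)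
    (hne : (bohrRadii (lpUnitBall p n)).Nonempty) :
    IsGreatest (bohrRadii (lpUnitBall p n)) (bohrRadius (lpUnitBall p n)) := by
  have : Fact (1 ≤ p) := ⟨hp⟩
  have hbdd : BddAbove (bohrRadii (lpUnitBall p n)) :=
    ⟨_, fun r hr => le_of_mem_bohrRadii_lpUnitBall hn hp hr (a := 1 / 2) (by norm_num)
      (by norm_num)⟩
  have hle : ∀ r ∈ bohrRadii (lpUnitBall p n), r ≤ bohrRadius (lpUnitBall p n) :=
    fun r hr => le_csSup hbdd hr
  have h0 : 0 ≤ bohrRadius (lpUnitBall p n) := by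
    obtain ⟨r, hr⟩ := hne
    exact hr.1.trans (hle r hr)
  refine ⟨⟨h0, fun c hc => ?_⟩, hle⟩
  rintro _ ⟨w, hw, rfl⟩
  -- The ball is open, so `w` already lies in `s` times the ball for some `s < 1`, and `K s` is at
  -- most some admissible radius.
  obtain ⟨s, hs1, hs2⟩ := exists_between (show
    ‖(WithLp.toLp p w : PiLp p (fun _ : Fin n => ℂ))‖ < 1 from hw)
  have hs0 : 0 < s := (norm_nonneg (WithLp.toLp p w : PiLp p (fun _ : Fin n => ℂ))).trans_lt hs1
  set K := bohrRadius (lpUnitBall p n) with hK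
  have hw' : s⁻¹ • w ∈ lpUnitBall p n := by
    unfold lpUnitBall
    rw [Set.mem_ofPred_eq, norm_toLp_smul hp, abs_of_nonneg (by positivity),
      inv_mul_lt_iff₀ hs0, mul_one]
    exact hs1
  have hmem : K • w ∈ (K * s) • lpUnitBall p n :=
    ⟨s⁻¹ • w, hw', by
      change (K * s) • s⁻¹ • w = K • w
      rw [smul_smul, mul_assoc, mul_inv_cancel₀ hs0.ne', mul_one]⟩
  obtain ⟨r, hr, hKr⟩ : ∃ r ∈ bohrRadii (lpUnitBall p n), K * s ≤ r := by
    rcases h0.eq_or_lt with h | h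
    · obtain ⟨r, hr⟩ := hne
      exact ⟨r, hr, by rw [← h, zero_mul]; exact hr.1⟩
    · obtain ⟨r, hr, hlt⟩ := exists_lt_of_lt_csSup hne
        (show K * s < sSup (bohrRadii (lpUnitBall p n)) by
          change K * s < K
          nlinarith)
      exact ⟨r, hr, hlt.le⟩
  exact hr.2 c hc _ (smul_lpUnitBall_subset hp (by positivity) hKr hmem)

/-! ### Upper bounds -/

/-- `log x / x` decreases from `e` on, and `5 / e^5 ≥ 1 / 30`; `n = 2 < e` is checked apart. -/
theorem one_div_thirty_le_log_div {n : ℕ} (hn : 1 < n) (hlog : Real.log n ≤ 5) :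
    1 / 30 ≤ Real.log n / n := by
  have hn0 : (0 : ℝ) < n := by exact_mod_cast (by omega : 0 < n)
  rcases Nat.lt_or_ge n 3 with h | h
  · have : n = 2 := by omega
    subst this
    push_cast
    linarith [Real.log_two_gt_d9]
  · have h3 : Real.exp 1 ≤ n := by
      have : (3 : ℝ) ≤ n := by exact_mod_cast h
      linarith [Real.exp_one_lt_d9]
    have h5 : (n : ℝ) ≤ Real.exp 5 := (Real.log_le_iff_le_exp hn0).1 hlog
    have := Real.log_div_self_antitoneOn (Set.mem_Ici.2 h3)
      (Set.mem_Ici.2 (Real.exp_le_exp.2 (by norm_num : (1 : ℝ) ≤ 5))) h5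
    simp only [Real.log_exp] at this
    refine le_trans ?_ this
    have he : Real.exp 5 ≤ 150 := by
      have : Real.exp 5 = Real.exp 1 ^ 5 := by rw [← Real.exp_nat_mul]; norm_num
      rw [this]
      calc Real.exp 1 ^ 5 ≤ 2.7182818286 ^ 5 := by
            gcongr; exact Real.exp_one_lt_d9.le
        _ ≤ 150 := by norm_num
    rw [div_le_div_iff₀ (by norm_num) (Real.exp_pos _)]
    linarith

theorem lt_two_mul_sqrt_of_log_le {n : ℕ} (hn : 1 < n) (hlog : Real.log n ≤ 5) {p : ℝ≥0∞}
    (hp : 1 ≤ p) {r : ℝ} (hr : r ∈ bohrRadii (lpUnitBall p n)) :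
    r < 2 * Real.sqrt (Real.log n / n) := by
  -- `a = 9 / 10` gives `r ≤ 5 / 14 < 2 * (9 / 50)`, while `(9 / 50)² ≤ 1 / 30`.
  have h1 := le_of_mem_bohrRadii_lpUnitBall (by omega) hp hr (a := 9 / 10) (by norm_num)
    (by norm_num)
  have h2 : (9 / 50 : ℝ) ≤ Real.sqrt (Real.log n / n) := by
    apply Real.le_sqrt_of_sq_le
    refine le_trans ?_ (one_div_thirty_le_log_div hn hlog)
    norm_num
  norm_num at h1
  linarith

theorem sqrt_le_rpow_one_sub {x q : ℝ} (hx0 : 0 < x) (hx1 : x ≤ 1) (hq0 : 0 < q) (hq2 : q ≤ 2) :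
    Real.sqrt x ≤ x ^ (1 - 1 / q) := by
  rw [Real.sqrt_eq_rpow]
  apply Real.rpow_le_rpow_of_exponent_ge hx0 hx1
  have : 1 / 2 ≤ 1 / q := one_div_le_one_div_of_le hq0 hq2
  linarith

/-- The upper bound for `1 ≤ p ≤ 2`. -/
theorem lt_three_mul_of_mem_bohrRadii {n : ℕ} (hn : 1 < n) {p : ℝ≥0∞} (hp : 1 ≤ p) (hp2 : p ≤ 2)
    {r : ℝ} (hr : r ∈ bohrRadii (lpUnitBall p n)) :
    r < 3 * (Real.log n / n) ^ (1 - 1 / p.toReal) := by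
  have hn1 : (1 : ℝ) < n := by exact_mod_cast hn
  have hn0 : (0 : ℝ) < n := by linarith
  have hlog : 0 < Real.log n := Real.log_pos hn1
  have hp' : p ≠ ∞ := ne_top_of_le_ne_top (by norm_num) hp2
  have hq1 : 1 ≤ p.toReal := by
    have := ENNReal.toReal_mono hp' hp
    simpa using this
  have hq2 : p.toReal ≤ 2 := by
    have := ENNReal.toReal_mono (by norm_num) hp2
    simpa using this
  have hx0 : 0 < Real.log n / n := by positivity
  have hx1 : Real.log n / n ≤ 1 := by
    rw [div_le_one hn0]
    linarith [Real.log_le_sub_one_of_pos hn0]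
  have hpos : 0 < (Real.log n / n) ^ (1 - 1 / p.toReal) := Real.rpow_pos_of_pos hx0 _
  rcases le_or_gt (Real.log n) 5 with h5 | h5
  · have h1 := lt_two_mul_sqrt_of_log_le hn h5 hp hr
    have h2 := sqrt_le_rpow_one_sub hx0 hx1 (by linarith) hq2
    linarith
  · obtain ⟨d, hd, hdlt⟩ := exists_degree h5
    obtain ⟨ε, hε, hM⟩ := exists_signPoly_le n (by omega) hd
    set e := 1 - 1 / p.toReal with he
    have he0 : 0 ≤ e := by
      have : 1 / p.toReal ≤ 1 := by rw [div_le_one (by linarith)]; exact hq1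
      linarith
    have he2 : e ≤ 1 / 2 := by
      have : 1 / 2 ≤ 1 / p.toReal := one_div_le_one_div_of_le (by linarith) hq2
      linarith
    have hd0 : (0 : ℝ) < d := by exact_mod_cast (by omega : 0 < d)
    have hf0 : (0 : ℝ) < d.factorial := by exact_mod_cast d.factorial_pos
    have hC : 0 < 16 * d * n * (d.factorial : ℝ) := by positivity
    have h1 := mul_rpow_pow_le_of_mem_bohrRadii (by omega) hp hr hε
      (Real.rpow_pos_of_pos (Real.sqrt_pos.2 hC) (2 * e))
      (fun z hz => norm_signPoly_interp (fun α => (hε α).le) hM hq1 hq2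
        ((mem_lpUnitBall_iff hp hp').1 hz).le)
    have h2 : Real.sqrt (16 * d * n * (d.factorial : ℝ)) ^ (2 * e) ≤
        ((4 * Real.log n) ^ e) ^ d := by
      rw [Real.sqrt_eq_rpow, ← Real.rpow_mul hC.le, ← Real.rpow_natCast,
        ← Real.rpow_mul (by positivity)]
      have e1 : 1 / 2 * (2 * e) = e := by ring
      rw [e1, mul_comm e, Real.rpow_mul (by positivity), Real.rpow_natCast]
      exact Real.rpow_le_rpow hC.le hdlt.le he0
    have h3 : r * (n : ℝ) ^ e ≤ (4 * Real.log n) ^ e :=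
      le_of_pow_le_pow_left₀ (by omega) (by positivity) (h1.trans h2)
    -- Since `e ≤ 1 / 2`, the constant is at most `2`; the gap up to `3` yields strictness.
    have h4 : (4 : ℝ) ^ e ≤ 2 := by
      calc (4 : ℝ) ^ e ≤ 4 ^ (1 / 2 : ℝ) :=
            Real.rpow_le_rpow_of_exponent_le (by norm_num) he2
        _ = 2 := by
          rw [← Real.sqrt_eq_rpow, show (4 : ℝ) = 2 ^ 2 by norm_num, Real.sqrt_sq (by norm_num)]
    have h5 : r ≤ 4 ^ e * (Real.log n / n) ^ e := by
      rw [Real.div_rpow hlog.le hn0.le, mul_div_assoc', le_div_iff₀ (by positivity),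
        ← Real.mul_rpow (by norm_num) hlog.le]
      exact h3
    nlinarith

/-- The upper bound for `2 ≤ p ≤ ∞`. -/
theorem lt_two_mul_sqrt_of_mem_bohrRadii {n : ℕ} (hn : 1 < n) {p : ℝ≥0∞} (hp2 : 2 ≤ p)
    {r : ℝ} (hr : r ∈ bohrRadii (lpUnitBall p n)) :
    r < 2 * Real.sqrt (Real.log n / n) := by
  have hn1 : (1 : ℝ) < n := by exact_mod_cast hn
  have hn0 : (0 : ℝ) < n := by linarith
  have hlog : 0 < Real.log n := Real.log_pos hn1
  have hp : 1 ≤ p := le_trans (by norm_num) hp2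
  rcases le_or_gt (Real.log n) 5 with h5 | h5
  · exact lt_two_mul_sqrt_of_log_le hn h5 hp hr
  · obtain ⟨d, hd, hdlt⟩ := exists_degree h5
    obtain ⟨ε, hε, hM⟩ := exists_signPoly_le n (by omega) hd
    have hd0 : (0 : ℝ) < d := by exact_mod_cast (by omega : 0 < d)
    have hf0 : (0 : ℝ) < d.factorial := by exact_mod_cast d.factorial_pos
    have hC : 0 < 16 * d * n * (d.factorial : ℝ) := by positivity
    set S := Real.sqrt (16 * d * n * (d.factorial : ℝ)) with hS
    have hS0 : 0 < S := Real.sqrt_pos.2 hC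
    -- Radius of a Euclidean ball containing the `ℓ_p` ball; division by `p.toReal = 0` correctly
    -- gives `√n` at `p = ∞`. As `n^{1 - 1/p} = b √n`, the factor `b^d` cancels later.
    set b : ℝ := (n : ℝ) ^ (1 / 2 - 1 / p.toReal) with hb
    have hb0 : 0 < b := by positivity
    have hb2 : b ^ 2 = (n : ℝ) ^ (1 - 2 / p.toReal) := by
      rw [hb, ← Real.rpow_natCast, ← Real.rpow_mul hn0.le]
      congr 1
      push_cast
      ring
    have hball : ∀ z ∈ lpUnitBall p n, ‖signPoly d ε z‖ ≤ b ^ d * S := by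
      intro z hz
      have h1 := sum_sq_le_of_mem_lpUnitBall hp2 hz
      have h2 := hM (fun j => (b : ℂ)⁻¹ * z j) (by
        simp_rw [norm_mul, norm_inv, Complex.norm_real, Real.norm_of_nonneg hb0.le, mul_pow]
        rw [← Finset.mul_sum, inv_pow, inv_mul_le_iff₀ (by positivity), mul_one, hb2]
        exact h1)
      rw [signPoly_smul, norm_mul, norm_pow, norm_inv, Complex.norm_real,
        Real.norm_of_nonneg hb0.le, inv_pow, inv_mul_le_iff₀ (by positivity)] at h2
      exact h2
    have h1 := mul_rpow_pow_le_of_mem_bohrRadii (by omega) hp hr hε (by positivity) hball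
    have h2 : (n : ℝ) ^ (1 - 1 / p.toReal) = b * Real.sqrt n := by
      rw [hb, Real.sqrt_eq_rpow, ← Real.rpow_add hn0]
      congr 1
      ring
    have h3 : (r * Real.sqrt n) ^ d ≤ S := by
      rw [h2, show r * (b * Real.sqrt n) = b * (r * Real.sqrt n) by ring, mul_pow] at h1
      exact le_of_mul_le_mul_left h1 (by positivity)
    have h4 : S < Real.sqrt (4 * Real.log n) ^ d := by
      rw [← Real.sqrt_eq_iff_mul_self_eq_of_pos (by positivity) |>.2
        (by rw [← mul_pow, Real.mul_self_sqrt (by positivity)] :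
          Real.sqrt (4 * Real.log n) ^ d * Real.sqrt (4 * Real.log n) ^ d =
            (4 * Real.log n) ^ d)]
      exact Real.sqrt_lt_sqrt hC.le hdlt
    have h5 : r * Real.sqrt n < Real.sqrt (4 * Real.log n) :=
      lt_of_pow_lt_pow_left₀ d (by positivity) (h3.trans_lt h4)
    have h6 : Real.sqrt (4 * Real.log n) = 2 * Real.sqrt (Real.log n) := by
      rw [show (4 : ℝ) = 2 ^ 2 by norm_num, Real.sqrt_mul (by norm_num),
        Real.sqrt_sq (by norm_num)]
    rw [Real.sqrt_div hlog.le, mul_div_assoc', lt_div_iff₀ (Real.sqrt_pos.2 hn0), ← h6]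
    exact h5

/-! ### The tree function series -/

/-- The coefficients `k ^ k / k!` of `1 / (1 - T)`, where `T` is the tree function. -/
noncomputable def treeCoeff (k : ℕ) : ℝ := (k : ℝ) ^ k / k.factorial

theorem treeCoeff_nonneg (k : ℕ) : 0 ≤ treeCoeff k := by
  unfold treeCoeff; positivity

theorem treeCoeff_le (k : ℕ) : treeCoeff k ≤ Real.exp 1 ^ k := by
  have h := Real.pow_div_factorial_le_exp (k : ℝ) (Nat.cast_nonneg k) k
  rwa [← Real.exp_nat_mul, mul_one]

/-- Multiplied by `m!`, the sum is the `m`-th finite difference of `t^m` at `0`, namely `m!`. It is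
the coefficient of `x^m` in `∑ k^k / k! x^k e^{-k x}`. -/
theorem sum_antidiagonal_treeCoeff (m : ℕ) :
    ∑ kl ∈ Finset.HasAntidiagonal.antidiagonal m,
      (kl.1 : ℂ) ^ kl.1 / kl.1.factorial * ((-(kl.1 : ℂ)) ^ kl.2 / kl.2.factorial) = 1 := by
  have h := congrFun (fwdDiff_iter_eq_factorial (R := ℂ) (n := m)) 0
  rw [fwdDiff_iter_eq_sum_shift, ← Finset.Nat.sum_antidiagonal_eq_sum_range_succ_mk
    (f := fun kl => ((-1 : ℤ) ^ (m - kl.1) * (m.choose kl.1 : ℤ)) •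
      ((0 : ℂ) + kl.1 • (1 : ℂ)) ^ m)] at h
  have hm : (m.factorial : ℂ) ≠ 0 := by exact_mod_cast m.factorial_ne_zero
  rw [Pi.natCast_apply] at h
  rw [← mul_right_inj' hm, mul_one]
  refine Eq.trans ?_ h
  rw [Finset.mul_sum]
  refine Finset.sum_congr rfl fun kl hkl => ?_
  have hsum := Finset.HasAntidiagonal.mem_antidiagonal.1 hkl
  have h1 : m - kl.1 = kl.2 := by omega
  have h2 : (m.choose kl.1 : ℂ) * kl.1.factorial * kl.2.factorial = m.factorial := by
    have := Nat.choose_mul_factorial_mul_factorial (show kl.1 ≤ m by omega)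
    rw [h1] at this
    exact_mod_cast this
  have h3 : (kl.1.factorial : ℂ) ≠ 0 := by exact_mod_cast kl.1.factorial_ne_zero
  have h4 : (kl.2.factorial : ℂ) ≠ 0 := by exact_mod_cast kl.2.factorial_ne_zero
  rw [h1, ← h2, neg_pow, zsmul_eq_mul, nsmul_eq_mul, mul_one, zero_add]
  push_cast
  rw [← hsum, pow_add]
  field_simp

theorem summable_treeCoeff_mul_pow {y : ℝ} (hy0 : 0 ≤ y) (hy : Real.exp 1 * y < 1) :
    Summable fun k => treeCoeff k * y ^ k := by
  refine Summable.of_nonneg_of_le (fun k => mul_nonneg (treeCoeff_nonneg k) (by positivity))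
    (fun k => ?_) (summable_geometric_of_lt_one (by positivity) hy)
  rw [mul_pow]
  gcongr
  exact treeCoeff_le k

/-- Expanding `e^{-k x}` gives an absolutely convergent double series, because `e |x| e^{|x|} < 1`
here; regrouping by total degree leaves the geometric series. -/
theorem tsum_treeCoeff_of_small {x : ℂ} (hx : ‖x‖ < 1 / 10) :
    ∑' k : ℕ, (treeCoeff k : ℂ) * (x * Complex.exp (-x)) ^ k = 1 / (1 - x) := by
  let t : ℕ × ℕ → ℂ := fun kl =>
    ((kl.1 : ℂ) ^ kl.1 / kl.1.factorial * x ^ kl.1) *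
      (((kl.2.factorial : ℂ)⁻¹) * (-(kl.1 * x)) ^ kl.2)
  have hrow : ∀ k : ℕ, HasSum (fun l => t (k, l))
      ((treeCoeff k : ℂ) * (x * Complex.exp (-x)) ^ k) := by
    intro k
    have h := (NormedSpace.expSeries_div_hasSum_exp (𝔸 := ℂ) (-(k * x))).mul_left
      ((k : ℂ) ^ k / k.factorial * x ^ k)
    rw [← Complex.exp_eq_exp_ℂ] at h
    have e : (treeCoeff k : ℂ) * (x * Complex.exp (-x)) ^ k =
        (k : ℂ) ^ k / k.factorial * x ^ k * Complex.exp (-(k * x)) := by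
      rw [mul_pow, ← Complex.exp_nat_mul, treeCoeff]
      push_cast
      rw [mul_neg, mul_assoc]
    rw [e]
    refine h.of_eq fun l => ?_
    simp only [t]
    rw [div_eq_inv_mul (_ ^ l)]
  have hrow' : ∀ k : ℕ, HasSum (fun l => ‖t (k, l)‖)
      (treeCoeff k * (‖x‖ * Real.exp ‖x‖) ^ k) := by
    intro k
    have h := (NormedSpace.expSeries_div_hasSum_exp (𝔸 := ℝ) (k * ‖x‖)).mul_left
      ((k : ℝ) ^ k / k.factorial * ‖x‖ ^ k)
    rw [← Real.exp_eq_exp_ℝ] at h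
    have e : treeCoeff k * (‖x‖ * Real.exp ‖x‖) ^ k =
        (k : ℝ) ^ k / k.factorial * ‖x‖ ^ k * Real.exp (k * ‖x‖) := by
      rw [mul_pow, ← Real.exp_nat_mul, treeCoeff, mul_assoc]
    rw [e]
    refine h.of_eq fun l => ?_
    simp [t, div_eq_inv_mul]
  have hexp : Real.exp ‖x‖ ≤ 10 / 9 := by
    have h1 := Real.one_sub_le_exp_neg ‖x‖
    rw [Real.exp_neg] at h1
    have h2 : (9 / 10 : ℝ) ≤ (Real.exp ‖x‖)⁻¹ := by linarith
    rw [le_inv_comm₀ (by norm_num) (Real.exp_pos _)] at h2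
    linarith
  have hsum : Summable t := by
    refine Summable.of_norm ((summable_prod_of_nonneg fun _ => norm_nonneg _).2
      ⟨fun k => (hrow' k).summable, ?_⟩)
    simp_rw [(hrow' _).tsum_eq]
    refine summable_treeCoeff_mul_pow (by positivity) ?_
    calc Real.exp 1 * (‖x‖ * Real.exp ‖x‖) ≤ 2.72 * (1 / 10 * (10 / 9)) := by
          gcongr
          linarith [Real.exp_one_lt_d9]
      _ < 1 := by norm_num
  have h1 : ∑' kl, t kl = ∑' k : ℕ, (treeCoeff k : ℂ) * (x * Complex.exp (-x)) ^ k := by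
    rw [hsum.tsum_prod]
    exact tsum_congr fun k => (hrow k).tsum_eq
  have h2 : ∑' kl, t kl = ∑' m : ℕ, x ^ m := by
    rw [← Finset.HasAntidiagonal.sigmaAntidiagonalEquivProd.tsum_eq]
    refine (((Finset.HasAntidiagonal.sigmaAntidiagonalEquivProd (A := ℕ)).summable_iff.2
      hsum).tsum_sigma).trans ?_
    refine tsum_congr fun m => ?_
    have h3 := (Finset.HasAntidiagonal.antidiagonal m).tsum_subtype t
    refine h3.trans ?_
    rw [← mul_one (x ^ m), ← sum_antidiagonal_treeCoeff m, Finset.mul_sum]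
    refine Finset.sum_congr rfl fun kl hkl => ?_
    simp only [t]
    rw [← Finset.HasAntidiagonal.mem_antidiagonal.1 hkl, pow_add, ← neg_mul, mul_pow]
    ring
  rw [← h1, h2, tsum_geometric_of_norm_lt_one (by linarith), one_div]

/-- As `k^k / k! ≤ e^k`, this gives uniform convergence on a disc containing both `0` and `1 / 3`,
so the identity near `0` continues analytically to `1 / 3`. -/
theorem norm_mul_exp_neg_le {x : ℂ} (hx : x ∈ Metric.ball (1 / 6 : ℂ) (1 / 6 + 1 / 100)) :
    Real.exp 1 * ‖x * Complex.exp (-x)‖ ≤ 19 / 20 := by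
  rw [mem_ball_iff_norm] at hx
  have h1 : ‖x‖ ≤ 1 / 3 + 1 / 100 := by
    have h := norm_add_le (x - 1 / 6) (1 / 6 : ℂ)
    rw [sub_add_cancel] at h
    have h' : ‖(1 / 6 : ℂ)‖ = 1 / 6 := by norm_num
    linarith
  have h2 : -x.re ≤ 1 / 100 := by
    have h := (Complex.abs_re_le_norm (x - 1 / 6)).trans hx.le
    have h' : (x - 1 / 6).re = x.re - 1 / 6 := by
      rw [Complex.sub_re]; norm_num
    rw [h'] at h
    linarith [(abs_le.1 h).1]
  have h3 : Real.exp (1 / 100) ≤ 100 / 99 := by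
    have h := Real.one_sub_le_exp_neg (1 / 100)
    rw [Real.exp_neg, le_inv_comm₀ (by norm_num) (Real.exp_pos _)] at h
    refine h.trans (by norm_num)
  rw [norm_mul, Complex.norm_exp, Complex.neg_re]
  calc Real.exp 1 * (‖x‖ * Real.exp (-x.re)) ≤ 2.7183 * ((1 / 3 + 1 / 100) * (100 / 99)) := by
        gcongr
        · linarith [Real.exp_one_lt_d9]
        · exact (Real.exp_le_exp.2 h2).trans h3
    _ ≤ _ := by norm_num

/-- The identity `∑ k ^ k / k! * (x e^{-x}) ^ k = 1 / (1 - x)` near the segment `[0, 1 / 3]`. -/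
theorem tsum_treeCoeff_of_mem_ball {x : ℂ}
    (hx : x ∈ Metric.ball (1 / 6 : ℂ) (1 / 6 + 1 / 100)) :
    ∑' k : ℕ, (treeCoeff k : ℂ) * (x * Complex.exp (-x)) ^ k = 1 / (1 - x) := by
  set U := Metric.ball (1 / 6 : ℂ) (1 / 6 + 1 / 100) with hU
  have hF : DifferentiableOn ℂ
      (fun x : ℂ => ∑' k : ℕ, (treeCoeff k : ℂ) * (x * Complex.exp (-x)) ^ k) U := by
    refine Complex.differentiableOn_tsum_of_summable_norm (u := fun k : ℕ => (19 / 20 : ℝ) ^ k)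
      (summable_geometric_of_lt_one (by norm_num) (by norm_num)) (fun k => ?_)
      Metric.isOpen_ball (fun k w hw => ?_)
    · fun_prop
    · rw [norm_mul, norm_pow, Complex.norm_real, Real.norm_of_nonneg (treeCoeff_nonneg k)]
      calc treeCoeff k * ‖w * Complex.exp (-w)‖ ^ k
          ≤ Real.exp 1 ^ k * ‖w * Complex.exp (-w)‖ ^ k := by
            gcongr; exact treeCoeff_le k
        _ = (Real.exp 1 * ‖w * Complex.exp (-w)‖) ^ k := (mul_pow _ _ _).symm
        _ ≤ _ := by
            gcongr; exact norm_mul_exp_neg_le hw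
  have hG : DifferentiableOn ℂ (fun x : ℂ => 1 / (1 - x)) U := by
    intro w hw
    have hne : 1 - w ≠ 0 := by
      intro h
      have : w = 1 := by linear_combination -h
      rw [hU, this, mem_ball_iff_norm] at hw
      norm_num at hw
    exact DifferentiableAt.differentiableWithinAt (by fun_prop (disch := exact hne))
  refine (hF.analyticOnNhd Metric.isOpen_ball).eqOn_of_preconnected_of_eventuallyEq
    (hG.analyticOnNhd Metric.isOpen_ball) (convex_ball _ _).isPreconnected (z₀ := 0)
    (by rw [mem_ball_iff_norm]; norm_num) ?_ hx
  filter_upwards [Metric.ball_mem_nhds (0 : ℂ) (show (0 : ℝ) < 1 / 10 by norm_num)] with w hw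
  exact tsum_treeCoeff_of_small (by simpa using hw)

/-- At `x = 1 / 3` the full series equals `3 / 2`; its term `k = 0` is `0^0 / 0! = 1`. -/
theorem sum_treeCoeff_le (N : ℕ) :
    ∑ k ∈ Finset.range N, treeCoeff (k + 1) * (1 / (3 * Real.exp (1 / 3))) ^ (k + 1) ≤ 1 / 2 := by
  set ρ : ℝ := 1 / (3 * Real.exp (1 / 3)) with hρ
  have hmem : ((1 / 3 : ℝ) : ℂ) ∈ Metric.ball (1 / 6 : ℂ) (1 / 6 + 1 / 100) := by
    rw [mem_ball_iff_norm]
    norm_num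
  have e : ((1 / 3 : ℝ) : ℂ) * Complex.exp (-((1 / 3 : ℝ) : ℂ)) = (ρ : ℂ) := by
    rw [← Complex.ofReal_neg, ← Complex.ofReal_exp, ← Complex.ofReal_mul, hρ, Real.exp_neg]
    congr 1
    field_simp
  have h1 := tsum_treeCoeff_of_mem_ball hmem
  have h2 := norm_mul_exp_neg_le hmem
  rw [e] at h1 h2
  have hρ0 : 0 ≤ ρ := by positivity
  rw [Complex.norm_real, Real.norm_of_nonneg hρ0] at h2
  have hs := summable_treeCoeff_mul_pow hρ0 (h2.trans_lt (by norm_num))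
  have h3 : ∑' k, treeCoeff k * ρ ^ k = 3 / 2 := by
    have : ((∑' k, treeCoeff k * ρ ^ k : ℝ) : ℂ) = ((3 / 2 : ℝ) : ℂ) := by
      rw [Complex.ofReal_tsum]
      push_cast at h1 ⊢
      rw [h1]
      norm_num
    exact_mod_cast this
  have h4 := hs.sum_le_tsum (Finset.range (N + 1))
    (fun k _ => mul_nonneg (treeCoeff_nonneg k) (by positivity))
  rw [h3, Finset.sum_range_succ'] at h4
  have h5 : treeCoeff 0 * ρ ^ 0 = 1 := by simp [treeCoeff]
  linarith

/-! ### Fourier analysis on the circle and the torus -/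

section Fourier

open scoped ComplexConjugate

open MeasureTheory AddCircle in
/-- If `f` is bounded by `1` on the circle and its `-k`-th Fourier coefficient vanishes, then its
Fourier coefficients satisfy `|f̂(0)| + |f̂(k)| / 2 ≤ 1`. -/
theorem norm_fourierCoeff_add_le {f : AddCircle (1 : ℝ) → ℂ} (hf : Continuous f)
    (hf1 : ∀ x, ‖f x‖ ≤ 1) {k : ℤ} (hk : k ≠ 0) (hneg : fourierCoeff f (-k) = 0) :
    ‖fourierCoeff f 0‖ + ‖fourierCoeff f k‖ / 2 ≤ 1 := by
  obtain ⟨c, hc1, hc2⟩ := exists_norm_eq_one_pow_mul one_pos (fourierCoeff f 0)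
  obtain ⟨c', hc1', hc2'⟩ := exists_norm_eq_one_pow_mul one_pos (fourierCoeff f k)
  rw [pow_one] at hc2 hc2'
  have hc0 : c ≠ 0 := norm_ne_zero_iff.1 (by rw [hc1]; exact one_ne_zero)
  set u := c⁻¹ * c' with hu
  have hu1 : ‖u‖ = 1 := by rw [hu, norm_mul, norm_inv, hc1, hc1']; norm_num
  -- A nonnegative kernel of mean `1`: integrating `f` against it gives `f̂(0) + u f̂(k) / 2`, and
  -- `u` aligns the two phases.
  let K : AddCircle (1 : ℝ) → ℝ := fun x => 1 + (u * fourier (-k) x).re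
  have hKc : Continuous K := by fun_prop
  have hK0 : ∀ x, 0 ≤ K x := by
    intro x
    have h1 : ‖u * fourier (-k) x‖ = 1 := by
      rw [norm_mul, hu1, fourier_apply, Circle.norm_coe, one_mul]
    have h2 := (abs_le.1 (Complex.abs_re_le_norm (u * fourier (-k) x))).1
    simp only [K]
    linarith
  have hKe : ∀ x, (K x : ℂ) = 1 + u / 2 * fourier (-k) x + conj u / 2 * fourier k x := by
    intro x
    simp only [K]
    rw [Complex.ofReal_add, Complex.re_eq_add_conj, map_mul, ← fourier_neg, neg_neg,
      Complex.ofReal_one]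
    ring
  have hint : ∀ g : AddCircle (1 : ℝ) → ℂ, Continuous g → Integrable g haarAddCircle :=
    fun g hg => by
      simpa using hg.continuousOn.integrableOn_compact (μ := haarAddCircle) isCompact_univ
  have hlin : ∀ g : AddCircle (1 : ℝ) → ℂ, Continuous g →
      ∫ x, (K x : ℂ) * g x ∂haarAddCircle =
        fourierCoeff g 0 + u / 2 * fourierCoeff g k + conj u / 2 * fourierCoeff g (-k) := by
    intro g hg
    simp only [fourierCoeff, smul_eq_mul, neg_zero, fourier_zero, one_mul, neg_neg]
    rw [← integral_const_mul, ← integral_const_mul, ← integral_add (hint _ hg)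
      (hint _ (by fun_prop)), ← integral_add (hint _ (by fun_prop)) (hint _ (by fun_prop))]
    refine integral_congr_ae (Filter.Eventually.of_forall fun x => ?_)
    simp only [hKe]
    ring
  have hK1 : ∫ x, K x ∂haarAddCircle = 1 := by
    have h := hlin (fourier 0) (map_continuous _)
    rw [fourierCoeff_fourier, Pi.single_eq_same, Pi.single_eq_of_ne hk,
      Pi.single_eq_of_ne (neg_ne_zero.2 hk)] at h
    simp only [fourier_zero, mul_one, mul_zero, add_zero] at h
    rw [integral_complex_ofReal] at h
    exact_mod_cast h
  have hbound : ‖∫ x, (K x : ℂ) * f x ∂haarAddCircle‖ ≤ 1 := by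
    refine (norm_integral_le_of_norm_le (g := K) ?_ (Filter.Eventually.of_forall fun x => ?_)).trans hK1.le
    · simpa using hKc.continuousOn.integrableOn_compact (μ := haarAddCircle) isCompact_univ
    · rw [norm_mul, Complex.norm_real, Real.norm_of_nonneg (hK0 x)]
      exact mul_le_of_le_one_right (hK0 x) (hf1 x)
  rw [hlin f hf, hneg, mul_zero, add_zero] at hbound
  have h1 : c * (fourierCoeff f 0 + u / 2 * fourierCoeff f k) =
      ((‖fourierCoeff f 0‖ + ‖fourierCoeff f k‖ / 2 : ℝ) : ℂ) := by
    rw [mul_add, hc2, hu]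
    push_cast
    rw [← hc2']
    field_simp
  have h2 : ‖c * (fourierCoeff f 0 + u / 2 * fourierCoeff f k)‖ ≤ 1 := by
    rw [norm_mul, hc1, one_mul]; exact hbound
  rw [h1, Complex.norm_real, Real.norm_of_nonneg (by positivity)] at h2
  exact h2

open MeasureTheory AddCircle in
theorem hasSum_fourierCoeff_tsum {ι : Type*} [Countable ι] {b : ι → ℂ} (hb : Summable b)
    (deg : ι → ℤ) (m : ℤ) :
    HasSum (fun i => if deg i = m then b i else 0)
      (fourierCoeff (fun x : AddCircle (1 : ℝ) => ∑' i, b i * fourier (deg i) x) m) := by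
  have hnorm : ∀ (m : ℤ) (x : AddCircle (1 : ℝ)), ‖fourier m x‖ = 1 := fun m x => by
    rw [fourier_apply, Circle.norm_coe]
  have h := hasSum_integral_of_summable_integral_norm (μ := haarAddCircle)
    (F := fun i (x : AddCircle (1 : ℝ)) => fourier (-m) x * (b i * fourier (deg i) x))
    (fun i => by
      have : Continuous fun x : AddCircle (1 : ℝ) =>
        fourier (-m) x * (b i * fourier (deg i) x) := by fun_prop
      simpa using this.continuousOn.integrableOn_compact (μ := haarAddCircle) isCompact_univ)
    (by
      simp only [norm_mul, hnorm, one_mul, mul_one, integral_const, probReal_univ, one_smul]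
      exact hb.norm)
  have e : ∀ i, ∫ x : AddCircle (1 : ℝ), fourier (-m) x * (b i * fourier (deg i) x) ∂haarAddCircle =
      if deg i = m then b i else 0 := by
    intro i
    have h1 : ∫ x : AddCircle (1 : ℝ), fourier (-m) x * (b i * fourier (deg i) x) ∂haarAddCircle =
        b i * fourierCoeff (fourier (deg i) : AddCircle (1 : ℝ) → ℂ) m := by
      rw [fourierCoeff, ← integral_const_mul]
      refine integral_congr_ae (Filter.Eventually.of_forall fun x => ?_)
      simp only [smul_eq_mul]
      ring
    rw [h1, fourierCoeff_fourier]
    by_cases hd : deg i = m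
    · rw [hd, Pi.single_eq_same, if_pos rfl, mul_one]
    · rw [Pi.single_eq_of_ne (Ne.symm hd), if_neg hd, mul_zero]
  simp only [e] at h
  simpa only [fourierCoeff, smul_eq_mul, ← tsum_mul_left] using h

theorem psTerm_smul {n : ℕ} (c : (Fin n → ℕ) → ℂ) (a : ℂ) (z : Fin n → ℂ) (α : Fin n → ℕ) :
    psTerm c (fun j => a * z j) α = a ^ (∑ j, α j) * psTerm c z α := by
  unfold psTerm
  rw [prod_smul_pow (Finset.mem_piAntidiag.2 ⟨rfl, by simp⟩)]
  ring

theorem psTerm_mul {n : ℕ} (c : (Fin n → ℕ) → ℂ) (ω z : Fin n → ℂ) (α : Fin n → ℕ) :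
    psTerm c (fun j => ω j * z j) α = psTerm c z α * ∏ j, ω j ^ α j := by
  unfold psTerm
  simp_rw [mul_pow]
  rw [Finset.prod_mul_distrib]
  ring

/-- A Reinhardt set is stable under multiplication by numbers of modulus one in each
coordinate. -/
def IsReinhardt {n : ℕ} (G : Set (Fin n → ℂ)) : Prop :=
  ∀ z ∈ G, ∀ ω : Fin n → ℂ, (∀ j, ‖ω j‖ = 1) → (fun j => ω j * z j) ∈ G

theorem isReinhardt_lpUnitBall {n : ℕ} {p : ℝ≥0∞} (hp : 1 ≤ p) :
    IsReinhardt (lpUnitBall p n) := by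
  intro z hz ω hω
  unfold lpUnitBall at hz ⊢
  rw [Set.mem_ofPred_eq] at hz ⊢
  refine lt_of_eq_of_lt ?_ hz
  have hn : ∀ j, ‖ω j * z j‖ = ‖z j‖ := fun j => by rw [norm_mul, hω, one_mul]
  rcases eq_or_ne p ∞ with rfl | hp'
  · rw [PiLp.norm_eq_ciSup, PiLp.norm_eq_ciSup]
    simp only [hn]
  · have hq : 0 < p.toReal := ENNReal.toReal_pos (by positivity) hp'
    rw [PiLp.norm_eq_sum hq, PiLp.norm_eq_sum hq]
    simp only [hn]

/-- Homogeneous parts of a power series bounded by `1`. -/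
theorem norm_add_norm_homogeneous_le {n : ℕ} {c : (Fin n → ℕ) → ℂ} {G : Set (Fin n → ℂ)}
    (hc : SumBoundedOn c G) (hG : IsReinhardt G) {w : Fin n → ℂ} (hw : w ∈ G) {k : ℕ}
    (hk : 0 < k) :
    ‖c 0‖ + ‖∑ α ∈ Finset.piAntidiag Finset.univ k, psTerm c w α‖ / 2 ≤ 1 := by
  have hb := (hc w hw).1
  let deg : (Fin n → ℕ) → ℤ := fun α => ((∑ j, α j : ℕ) : ℤ)
  -- The series along the circle through `w`: its `m`-th Fourier coefficient is the part of degree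
  -- `m`, and negative ones vanish.
  let f : AddCircle (1 : ℝ) → ℂ := fun x => ∑' α, psTerm c w α * fourier (deg α) x
  have hnorm : ∀ (m : ℤ) (x : AddCircle (1 : ℝ)), ‖fourier m x‖ = 1 := fun m x => by
    rw [fourier_apply, Circle.norm_coe]
  have hf : Continuous f := by
    refine continuous_tsum (fun α => by fun_prop) hb.norm fun α x => ?_
    rw [norm_mul, hnorm, mul_one]
  have hfx : ∀ x, f x = ∑' α, psTerm c (fun j => (fourier 1 x : ℂ) * w j) α := by
    intro x
    refine tsum_congr fun α => ?_
    rw [psTerm_smul, mul_comm]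
    congr 1
    simp only [deg, fourier_apply, one_zsmul, natCast_zsmul, AddCircle.toCircle_nsmul,
      Circle.coe_pow]
  have hf1 : ∀ x, ‖f x‖ ≤ 1 := fun x => by
    rw [hfx]
    exact (hc _ (hG w hw _ fun _ => hnorm 1 x)).2
  have hcoeff : ∀ m : ℕ, fourierCoeff f m =
      ∑ α ∈ Finset.piAntidiag Finset.univ m, psTerm c w α := by
    intro m
    refine (hasSum_fourierCoeff_tsum hb deg m).unique ?_
    have hmem : ∀ α : Fin n → ℕ, α ∈ Finset.piAntidiag Finset.univ m ↔ deg α = m := by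
      intro α
      rw [Finset.mem_piAntidiag]
      exact ⟨fun h => congrArg Nat.cast h.1, fun h => ⟨Nat.cast_injective h, by simp⟩⟩
    convert hasSum_sum_of_ne_finset_zero
      (f := fun α => if deg α = (m : ℤ) then psTerm c w α else 0)
      (s := Finset.piAntidiag Finset.univ m) (fun α hα => if_neg fun h => hα ((hmem α).2 h)) using 1
    · exact Finset.sum_congr rfl fun α hα => (if_pos ((hmem α).1 hα)).symm
    · infer_instance
  have hneg : fourierCoeff f (-(k : ℤ)) = 0 := by
    refine (hasSum_fourierCoeff_tsum hb deg (-(k : ℤ))).unique ?_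
    convert hasSum_zero using 1
    funext α
    apply if_neg
    simp only [deg]
    omega
  have h := norm_fourierCoeff_add_le hf hf1 (by exact_mod_cast hk.ne' : (k : ℤ) ≠ 0) hneg
  have h0 := hcoeff 0
  rw [Finset.piAntidiag_zero, Finset.sum_singleton] at h0
  have h00 : psTerm c w 0 = c 0 := by simp [psTerm]
  rw [hcoeff k] at h
  rw [h00] at h0
  rwa [← h0]

theorem sum_stdAddChar_pow_mul_conj {N : ℕ} [NeZero N] {a b : ℕ} (ha : a < N) (hb : b < N) :
    ∑ t : ZMod N, ZMod.stdAddChar t ^ a * conj (ZMod.stdAddChar t ^ b) =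
      if a = b then (N : ℂ) else 0 := by
  have h := AddChar.sum_mulShift (R := ZMod N) (R' := ℂ) ((a : ZMod N) - b)
    (ZMod.isPrimitive_stdAddChar N)
  have e : ((a : ZMod N) - b = 0) ↔ a = b := by
    rw [sub_eq_zero, ZMod.natCast_eq_natCast_iff', Nat.mod_eq_of_lt ha, Nat.mod_eq_of_lt hb]
  simp only [e, ZMod.card] at h
  rw [← Nat.cast_zero, ← Nat.cast_ite, ← h]
  refine Finset.sum_congr rfl fun t _ => ?_
  rw [mul_sub, sub_eq_add_neg, AddChar.map_add_eq_mul, map_pow, ← AddChar.map_neg_eq_conj,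
    ← AddChar.map_nsmul_eq_pow, ← AddChar.map_nsmul_eq_pow, nsmul_eq_mul, nsmul_eq_mul]
  congr 2 <;> ring

/-- A Bessel inequality for polynomials bounded on the torus. -/
theorem sum_sq_le_of_bounded_on_torus {n : ℕ} (S : Finset (Fin n → ℕ)) (b : (Fin n → ℕ) → ℂ)
    {C : ℝ} (hC : ∀ ω : Fin n → ℂ, (∀ j, ‖ω j‖ = 1) → ‖∑ α ∈ S, b α * ∏ j, ω j ^ α j‖ ≤ C) :
    ∑ α ∈ S, ‖b α‖ ^ 2 ≤ C ^ 2 := by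
  obtain ⟨k, hk⟩ : ∃ k : ℕ, ∀ α ∈ S, ∀ j, α j ≤ k := by
    refine ⟨∑ α ∈ S, ∑ j, α j, fun α hα j => ?_⟩
    exact (Finset.single_le_sum (f := fun j => α j) (fun _ _ => Nat.zero_le _)
      (Finset.mem_univ j)).trans
      (Finset.single_le_sum (f := fun α : Fin n → ℕ => ∑ j, α j) (fun _ _ => Nat.zero_le _) hα)
  -- With `N` above every exponent, averaging over `N`-th roots of unity keeps the monomials
  -- orthogonal, so finite sums replace torus integrals.
  let N := k + 1
  let χ : (Fin n → ℕ) → (Fin n → ZMod N) → ℂ := fun α t => ∏ j, ZMod.stdAddChar (t j) ^ α j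
  have horth : ∀ α ∈ S, ∀ β ∈ S, ∑ t, χ α t * conj (χ β t) = if α = β then (N : ℂ) ^ n else 0 := by
    intro α hα β hβ
    have h1 : ∀ t, χ α t * conj (χ β t) =
        ∏ j, (ZMod.stdAddChar (t j) ^ α j * conj (ZMod.stdAddChar (t j) ^ β j)) := by
      intro t
      simp only [χ]
      rw [map_prod, Finset.prod_mul_distrib]
    simp_rw [h1]
    rw [← Fintype.piFinset_univ]
    refine (Finset.prod_univ_sum (fun _ => Finset.univ) (fun j (s : ZMod N) =>
      (ZMod.stdAddChar s ^ α j * conj (ZMod.stdAddChar s ^ β j) : ℂ))).symm.trans ?_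
    have h2 : ∀ j, ∑ s : ZMod N, (ZMod.stdAddChar s ^ α j * conj (ZMod.stdAddChar s ^ β j) : ℂ) =
        if α j = β j then (N : ℂ) else 0 := fun j =>
      sum_stdAddChar_pow_mul_conj (Nat.lt_succ_of_le (hk α hα j)) (Nat.lt_succ_of_le (hk β hβ j))
    simp_rw [h2]
    split_ifs with h
    · subst h
      simp
    · obtain ⟨j, hj⟩ := Function.ne_iff.1 h
      exact Finset.prod_eq_zero (Finset.mem_univ j) (if_neg hj)
  let Q : (Fin n → ZMod N) → ℂ := fun t => ∑ α ∈ S, b α * χ α t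
  have hQ : ∀ t, ‖Q t‖ ≤ C := fun t =>
    hC (fun j => ZMod.stdAddChar (t j)) fun j => by
      rw [ZMod.stdAddChar_apply, Circle.norm_coe]
  have hsum : ((∑ t, ‖Q t‖ ^ 2 : ℝ) : ℂ) = (((N : ℝ) ^ n * ∑ α ∈ S, ‖b α‖ ^ 2 : ℝ) : ℂ) := by
    have h1 : ∀ t, ((‖Q t‖ ^ 2 : ℝ) : ℂ) =
        ∑ α ∈ S, ∑ β ∈ S, b α * conj (b β) * (χ α t * conj (χ β t)) := by
      intro t
      push_cast
      rw [← Complex.mul_conj']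
      simp only [Q]
      rw [map_sum, Finset.sum_mul_sum]
      refine Finset.sum_congr rfl fun α _ => Finset.sum_congr rfl fun β _ => ?_
      rw [map_mul]
      ring
    rw [Complex.ofReal_sum]
    simp_rw [h1]
    rw [Finset.sum_comm, Complex.ofReal_mul, Complex.ofReal_sum, Finset.mul_sum]
    refine Finset.sum_congr rfl fun α hα => ?_
    rw [Finset.sum_comm]
    simp_rw [← Finset.mul_sum]
    rw [Finset.sum_congr rfl fun β hβ => by rw [horth α hα β hβ], Finset.sum_eq_single α]
    · rw [if_pos rfl, Complex.mul_conj']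
      push_cast
      ring
    · intro β _ hβ
      rw [if_neg (Ne.symm hβ), mul_zero]
    · intro h
      exact absurd hα h
  have hsum' : ∑ t, ‖Q t‖ ^ 2 = (N : ℝ) ^ n * ∑ α ∈ S, ‖b α‖ ^ 2 := by exact_mod_cast hsum
  have hle : ∑ t, ‖Q t‖ ^ 2 ≤ (N : ℝ) ^ n * C ^ 2 := by
    calc ∑ t, ‖Q t‖ ^ 2 ≤ ∑ _t : Fin n → ZMod N, C ^ 2 :=
          Finset.sum_le_sum fun t _ => by
            have := hQ t
            gcongr
      _ = _ := by simp [ZMod.card]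
  rw [hsum'] at hle
  exact le_of_mul_le_mul_left hle (by positivity)

end Fourier

/-! ### Lower bounds from homogeneous parts -/

/-- The bound on the degree-`k` part holds on the whole torus through `w`, so Bessel's inequality
applies. -/
theorem sum_sq_psTerm_le {n : ℕ} {c : (Fin n → ℕ) → ℂ} {G : Set (Fin n → ℂ)}
    (hc : SumBoundedOn c G) (hG : IsReinhardt G) {w : Fin n → ℂ} (hw : w ∈ G) {k : ℕ}
    (hk : 0 < k) :
    ∑ α ∈ Finset.piAntidiag Finset.univ k, ‖psTerm c w α‖ ^ 2 ≤ (2 * (1 - ‖c 0‖)) ^ 2 := by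
  refine sum_sq_le_of_bounded_on_torus _ (psTerm c w) fun ω hω => ?_
  have h := norm_add_norm_homogeneous_le hc hG (hG w hw ω hω) hk
  simp only [psTerm_mul] at h
  linarith

/-- A criterion for admissible radii in terms of homogeneous parts. -/
theorem mem_bohrRadii_of_homogeneous {n : ℕ} {G : Set (Fin n → ℂ)} (hG : IsReinhardt G) {r : ℝ}
    (hr : 0 ≤ r) {s : ℕ → ℝ} (hs : ∀ N, ∑ k ∈ Finset.range N, s (k + 1) ≤ 1 / 2)
    (h : ∀ c, SumBoundedOn c G → ∀ z ∈ r • G, ∀ k, 0 < k →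
      ∑ α ∈ Finset.piAntidiag Finset.univ k, ‖psTerm c z α‖ ≤ 2 * (1 - ‖c 0‖) * s k) :
    r ∈ bohrRadii G := by
  classical
  refine ⟨hr, fun c hc z hz => ?_⟩
  have hc0 : ‖c 0‖ ≤ 1 := by
    obtain ⟨w, hw, -⟩ := hz
    have := norm_add_norm_homogeneous_le hc hG hw one_pos
    linarith [norm_nonneg (∑ α ∈ Finset.piAntidiag Finset.univ 1, psTerm c w α)]
  have hfin : ∀ S : Finset (Fin n → ℕ), ∑ α ∈ S, ‖psTerm c z α‖ ≤ 1 := by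
    intro S
    obtain ⟨N, hN⟩ : ∃ N : ℕ, ∀ α ∈ S, ∑ j, α j ≤ N :=
      ⟨∑ α ∈ S, ∑ j, α j, fun α hα =>
        Finset.single_le_sum (f := fun α : Fin n → ℕ => ∑ j, α j) (fun _ _ => Nat.zero_le _) hα⟩
    have hsub : S ⊆ (Finset.range (N + 1)).biUnion fun k => Finset.piAntidiag Finset.univ k := by
      intro α hα
      rw [Finset.mem_biUnion]
      exact ⟨∑ j, α j, Finset.mem_range.2 (Nat.lt_succ_of_le (hN α hα)),
        Finset.mem_piAntidiag.2 ⟨rfl, by simp⟩⟩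
    refine (Finset.sum_le_sum_of_subset_of_nonneg hsub fun _ _ _ => norm_nonneg _).trans ?_
    rw [Finset.sum_biUnion, Finset.sum_range_succ']
    · have h0 : ∑ α ∈ Finset.piAntidiag (Finset.univ : Finset (Fin n)) 0, ‖psTerm c z α‖ =
          ‖c 0‖ := by
        rw [Finset.piAntidiag_zero, Finset.sum_singleton]
        simp [psTerm]
      rw [h0]
      have h1 : ∑ k ∈ Finset.range N,
          ∑ α ∈ Finset.piAntidiag (Finset.univ : Finset (Fin n)) (k + 1), ‖psTerm c z α‖ ≤
          2 * (1 - ‖c 0‖) * (1 / 2) := by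
        refine (Finset.sum_le_sum fun k _ => h c hc z hz (k + 1) k.succ_pos).trans ?_
        rw [← Finset.mul_sum]
        exact mul_le_mul_of_nonneg_left (hs N) (by linarith)
      linarith
    · intro k _ l _ hkl
      rw [Function.onFun, Finset.disjoint_left]
      intro α hα hα'
      exact hkl ((Finset.mem_piAntidiag.1 hα).1.symm.trans (Finset.mem_piAntidiag.1 hα').1)
  have hsum : Summable fun α => ‖psTerm c z α‖ :=
    summable_of_sum_le (fun _ => norm_nonneg _) hfin
  exact ⟨hsum, hsum.tsum_le_of_sum_le hfin⟩

/-- The multinomial coefficients are at least `1` and sum to `n^k`. -/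
theorem card_piAntidiag_le (n k : ℕ) :
    (Finset.piAntidiag (Finset.univ : Finset (Fin n)) k).card ≤ n ^ k := by
  have h := Finset.sum_pow_eq_sum_piAntidiag (Finset.univ : Finset (Fin n)) (fun _ => (1 : ℕ)) k
  simp only [Finset.sum_const, Finset.card_univ, Fintype.card_fin, smul_eq_mul, mul_one, one_pow,
    Finset.prod_const_one, Nat.cast_id] at h
  rw [h, Finset.card_eq_sum_ones]
  exact Finset.sum_le_sum fun α _ => Nat.multinomial_pos _ _

/-- The lower bound `1 / (3 √n)`, valid for every Reinhardt set. -/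
theorem sqrt_mem_bohrRadii {n : ℕ} (hn : 0 < n) {G : Set (Fin n → ℂ)} (hG : IsReinhardt G) :
    1 / 3 * Real.sqrt (1 / (n : ℝ)) ∈ bohrRadii G := by
  have hnR : (0 : ℝ) < n := by exact_mod_cast hn
  set r := 1 / 3 * Real.sqrt (1 / (n : ℝ)) with hr
  have hr0 : 0 ≤ r := by positivity
  refine mem_bohrRadii_of_homogeneous hG hr0 (s := fun k => (1 / 3 : ℝ) ^ k) (fun N => ?_) ?_
  · simp_rw [pow_succ']
    rw [← Finset.mul_sum, geom_sum_eq (by norm_num)]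
    have h1 : (0 : ℝ) ≤ (1 / 3) ^ N := by positivity
    have h2 : (1 / 3 : ℝ) * (((1 / 3) ^ N - 1) / (1 / 3 - 1)) = (1 - (1 / 3) ^ N) / 2 := by ring
    linarith
  · rintro c hc _ ⟨w, hw, rfl⟩ k hk
    have hc0 : ‖c 0‖ ≤ 1 := by
      have := norm_add_norm_homogeneous_le hc hG hw one_pos
      linarith [norm_nonneg (∑ α ∈ Finset.piAntidiag Finset.univ 1, psTerm c w α)]
    have h1 := sum_sq_psTerm_le hc hG hw hk
    have h2 : ∀ α ∈ Finset.piAntidiag (Finset.univ : Finset (Fin n)) k,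
        ‖psTerm c (r • w) α‖ = r ^ k * ‖psTerm c w α‖ := by
      intro α hα
      have : r • w = fun j => (r : ℂ) * w j := by
        funext j; rw [Pi.smul_apply, Complex.real_smul]
      rw [this, psTerm_smul, norm_mul, norm_pow, Complex.norm_real, Real.norm_of_nonneg hr0,
        show ∑ j, α j = k from (Finset.mem_piAntidiag.1 hα).1]
    change ∑ α ∈ Finset.piAntidiag Finset.univ k, ‖psTerm c (r • w) α‖ ≤ _
    rw [Finset.sum_congr rfl h2, ← Finset.mul_sum]
    have h3 : ∑ α ∈ Finset.piAntidiag (Finset.univ : Finset (Fin n)) k, ‖psTerm c w α‖ ≤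
        2 * (1 - ‖c 0‖) * Real.sqrt n ^ k := by
      -- Cauchy–Schwarz over the monomials costs `√(n^k)`, absorbed by the `√n` in `r`.
      have h4 := sq_sum_le_card_mul_sum_sq (s := Finset.piAntidiag (Finset.univ : Finset (Fin n)) k)
        (f := fun α => ‖psTerm c w α‖)
      have h5 : ((Finset.piAntidiag (Finset.univ : Finset (Fin n)) k).card : ℝ) ≤
          (Real.sqrt n ^ k) ^ 2 := by
        rw [← pow_mul, mul_comm k, pow_mul, Real.sq_sqrt hnR.le]
        exact_mod_cast card_piAntidiag_le n k
      refine le_of_pow_le_pow_left₀ two_ne_zero (mul_nonneg (by linarith) (by positivity)) ?_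
      calc _ ≤ _ := h4
        _ ≤ (Real.sqrt n ^ k) ^ 2 * (2 * (1 - ‖c 0‖)) ^ 2 := by gcongr
        _ = _ := by ring
    calc r ^ k * ∑ α ∈ Finset.piAntidiag (Finset.univ : Finset (Fin n)) k, ‖psTerm c w α‖
        ≤ r ^ k * (2 * (1 - ‖c 0‖) * Real.sqrt n ^ k) := by gcongr
      _ = 2 * (1 - ‖c 0‖) * (r * Real.sqrt n) ^ k := by rw [mul_pow]; ring
      _ = _ := by
        have : r * Real.sqrt n = 1 / 3 := by
          rw [hr, mul_assoc, ← Real.sqrt_mul (by positivity), one_div_mul_cancel hnR.ne',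
            Real.sqrt_one, mul_one]
        rw [this]

/-! ### Lower bound from Cauchy's estimates -/

theorem pow_le_multinomial_mul {n k : ℕ} {α : Fin n → ℕ}
    (hα : α ∈ Finset.piAntidiag Finset.univ k) :
    k.factorial ≤ Nat.multinomial Finset.univ α * ∏ j, α j ^ α j := by
  have h := Nat.multinomial_spec Finset.univ α
  rw [show ∑ j, α j = k from (Finset.mem_piAntidiag.1 hα).1] at h
  rw [← h, mul_comm]
  exact Nat.mul_le_mul_left _ (Finset.prod_le_prod' fun j _ => Nat.factorial_le_pow _)

/-- Cauchy's estimate for the coefficients, tested on the simplex contained in the `ℓ_p` ball. -/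
theorem norm_coeff_le {n : ℕ} {p : ℝ≥0∞} (hp : 1 ≤ p) {c : (Fin n → ℕ) → ℂ}
    (hc : SumBoundedOn c (lpUnitBall p n)) {k : ℕ} (hk : 0 < k) {α : Fin n → ℕ}
    (hα : α ∈ Finset.piAntidiag Finset.univ k) {t : ℝ} (ht0 : 0 < t) (ht1 : t < 1) :
    ‖c α‖ * t ^ k ≤ 2 * (1 - ‖c 0‖) * treeCoeff k * Nat.multinomial Finset.univ α := by
  have hsum : ∑ j, α j = k := (Finset.mem_piAntidiag.1 hα).1
  have hkR : (0 : ℝ) < k := by exact_mod_cast hk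
  -- This point maximises `|w^α|` on the simplex `∑ |w_j| ≤ t`, which lies in every `ℓ_p` ball since
  -- `t < 1`.
  let w : Fin n → ℂ := fun j => ((t / k * α j : ℝ) : ℂ)
  have hwn : ∀ j, ‖w j‖ = t / k * α j := fun j => by
    simp only [w]
    rw [Complex.norm_real, Real.norm_of_nonneg (by positivity)]
  have hw1 : ∑ j, ‖w j‖ = t := by
    simp_rw [hwn]
    rw [← Finset.mul_sum, ← Nat.cast_sum, hsum]
    field_simp
  have hwle : ∀ j, ‖w j‖ ≤ t := fun j => by
    rw [← hw1]
    exact Finset.single_le_sum (f := fun j => ‖w j‖) (fun _ _ => norm_nonneg _) (Finset.mem_univ j)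
  have hw : w ∈ lpUnitBall p n := by
    rcases eq_or_ne p ∞ with rfl | hp'
    · unfold lpUnitBall
      rw [Set.mem_ofPred_eq, PiLp.norm_eq_ciSup]
      exact (Real.iSup_le hwle ht0.le).trans_lt ht1
    · rw [mem_lpUnitBall_iff hp hp']
      have hq : 1 ≤ p.toReal := by
        have := ENNReal.toReal_mono hp' hp
        simpa using this
      refine lt_of_le_of_lt (Finset.sum_le_sum fun j _ => ?_) (hw1.trans_lt ht1)
      calc ‖w j‖ ^ p.toReal ≤ ‖w j‖ ^ (1 : ℝ) :=
            Real.rpow_le_rpow_of_exponent_ge_of_imp (norm_nonneg _) ((hwle j).trans ht1.le) hq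
              (by intro _ h; linarith)
        _ = ‖w j‖ := Real.rpow_one _
  have hG := isReinhardt_lpUnitBall (n := n) hp
  have hc0 : ‖c 0‖ ≤ 1 := by
    have := norm_add_norm_homogeneous_le hc hG hw one_pos
    linarith [norm_nonneg (∑ α ∈ Finset.piAntidiag Finset.univ 1, psTerm c w α)]
  have h1 : ‖psTerm c w α‖ ≤ 2 * (1 - ‖c 0‖) := by
    refine le_of_pow_le_pow_left₀ two_ne_zero (by linarith) ?_
    exact (Finset.single_le_sum (f := fun α => ‖psTerm c w α‖ ^ 2) (fun _ _ => by positivity)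
      hα).trans (sum_sq_psTerm_le hc hG hw hk)
  have h2 : ‖psTerm c w α‖ = ‖c α‖ * ((t / k) ^ k * ∏ j, (α j : ℝ) ^ α j) := by
    unfold psTerm
    rw [norm_mul, norm_prod]
    simp_rw [norm_pow, hwn]
    rw [prod_smul_pow hα]
  rw [h2] at h1
  have h3 : (k.factorial : ℝ) ≤ Nat.multinomial Finset.univ α * ∏ j, (α j : ℝ) ^ α j := by
    exact_mod_cast pow_le_multinomial_mul hα
  have hm : (0 : ℝ) < Nat.multinomial Finset.univ α := by
    exact_mod_cast Nat.multinomial_pos _ _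
  have hf : (0 : ℝ) < k.factorial := by exact_mod_cast k.factorial_pos
  rw [treeCoeff]
  calc ‖c α‖ * t ^ k = ‖c α‖ * ((t / k) ^ k * k.factorial) * (k ^ k / k.factorial) := by
        rw [div_pow]; field_simp
    _ ≤ ‖c α‖ * ((t / k) ^ k * (Nat.multinomial Finset.univ α * ∏ j, (α j : ℝ) ^ α j)) *
          (k ^ k / k.factorial) := by gcongr
    _ = (‖c α‖ * ((t / k) ^ k * ∏ j, (α j : ℝ) ^ α j)) *
          (Nat.multinomial Finset.univ α * (k ^ k / k.factorial)) := by ring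
    _ ≤ (2 * (1 - ‖c 0‖)) * (Nat.multinomial Finset.univ α * (k ^ k / k.factorial)) := by gcongr
    _ = _ := by ring

/-- The lower bound for `1 ≤ p < ∞` coming from Cauchy's estimates. -/
theorem rpow_mem_bohrRadii_lpUnitBall {n : ℕ} (hn : 0 < n) {p : ℝ≥0∞} (hp : 1 ≤ p)
    (hp' : p ≠ ∞) :
    1 / (3 * Real.exp (1 / 3)) * (1 / (n : ℝ)) ^ (1 - 1 / p.toReal) ∈
      bohrRadii (lpUnitBall p n) := by
  have hnR : (0 : ℝ) < n := by exact_mod_cast hn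
  have hq : 1 ≤ p.toReal := by
    have := ENNReal.toReal_mono hp' hp
    simpa using this
  have hG := isReinhardt_lpUnitBall (n := n) hp
  set ρ : ℝ := 1 / (3 * Real.exp (1 / 3)) with hρ
  have hρ0 : 0 < ρ := by positivity
  refine mem_bohrRadii_of_homogeneous hG (by positivity) (s := fun k => treeCoeff k * ρ ^ k)
    sum_treeCoeff_le ?_
  rintro c hc _ ⟨v, hv, rfl⟩ k hk
  have hc0 : ‖c 0‖ ≤ 1 := by
    have := norm_add_norm_homogeneous_le hc hG hv one_pos
    linarith [norm_nonneg (∑ α ∈ Finset.piAntidiag Finset.univ 1, psTerm c v α)]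
  set r := ρ * (1 / (n : ℝ)) ^ (1 - 1 / p.toReal) with hr
  have hr0 : 0 ≤ r := by positivity
  change ∑ α ∈ Finset.piAntidiag Finset.univ k, ‖psTerm c (r • v) α‖ ≤ _
  have hv1 := (mem_lpUnitBall_iff hp hp').1 hv
  have hτ : (∑ j, ‖v j‖ ^ p.toReal) ^ (1 / p.toReal) < 1 :=
    Real.rpow_lt_one (by positivity) hv1 (by positivity)
  -- Cauchy's estimate on the open ball loses `t^k`; taking `t` above the norm of `v` gives `∑ r
  -- |v_j| ≤ ρ t`, which recovers it.
  obtain ⟨t, ht, ht1⟩ := exists_between hτ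
  have ht0 : 0 < t := lt_of_le_of_lt (by positivity) ht
  have hz : ∑ j, r * ‖v j‖ ≤ ρ * t := by
    rw [← Finset.mul_sum]
    have h1 := sum_le_card_rpow_mul (a := fun j => ‖v j‖) (fun j => norm_nonneg _) hq
    calc r * ∑ j, ‖v j‖ ≤ r * ((n : ℝ) ^ (1 - 1 / p.toReal) * t) := by
          refine mul_le_mul_of_nonneg_left (h1.trans ?_) hr0
          gcongr
      _ = ρ * t := by
          have : (1 / (n : ℝ)) ^ (1 - 1 / p.toReal) * (n : ℝ) ^ (1 - 1 / p.toReal) = 1 := by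
            rw [← Real.mul_rpow (by positivity) hnR.le, one_div_mul_cancel hnR.ne', Real.one_rpow]
          rw [hr]
          linear_combination (ρ * t) * this
  have hterm : ∀ α ∈ Finset.piAntidiag (Finset.univ : Finset (Fin n)) k,
      ‖psTerm c (r • v) α‖ * t ^ k ≤ 2 * (1 - ‖c 0‖) * treeCoeff k *
        (Nat.multinomial Finset.univ α * ∏ j, (r * ‖v j‖) ^ α j) := by
    intro α hα
    have h1 := norm_coeff_le hp hc hk hα ht0 ht1
    have h2 : ‖psTerm c (r • v) α‖ = ‖c α‖ * ∏ j, (r * ‖v j‖) ^ α j := by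
      unfold psTerm
      rw [norm_mul, norm_prod]
      congr 1
      refine Finset.prod_congr rfl fun j _ => ?_
      rw [norm_pow, Pi.smul_apply, norm_smul, Real.norm_of_nonneg hr0]
    have h3 : 0 ≤ ∏ j, (r * ‖v j‖) ^ α j := Finset.prod_nonneg fun j _ => by positivity
    rw [h2]
    calc ‖c α‖ * (∏ j, (r * ‖v j‖) ^ α j) * t ^ k
        = (‖c α‖ * t ^ k) * ∏ j, (r * ‖v j‖) ^ α j := by ring
      _ ≤ _ := mul_le_mul_of_nonneg_right h1 h3
      _ = _ := by ring
  have hsum := Finset.sum_le_sum hterm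
  rw [← Finset.sum_mul, ← Finset.mul_sum, ← Finset.sum_pow_eq_sum_piAntidiag] at hsum
  have htk : 0 < t ^ k := by positivity
  refine le_of_mul_le_mul_right (hsum.trans ?_) htk
  have hA : 0 ≤ 2 * (1 - ‖c 0‖) * treeCoeff k :=
    mul_nonneg (by linarith) (treeCoeff_nonneg k)
  calc 2 * (1 - ‖c 0‖) * treeCoeff k * (∑ j, r * ‖v j‖) ^ k
      ≤ 2 * (1 - ‖c 0‖) * treeCoeff k * (ρ * t) ^ k := by gcongr
    _ = _ := by rw [mul_pow]; ring

theorem mainTheorem1 (n : ℕ) (hn : 1 < n) (p : ℝ≥0∞) (hp : 1 ≤ p) :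
    -- the Bohr radius is attained, so it is indeed the largest admissible radius
    IsGreatest (bohrRadii (lpUnitBall p n)) (bohrRadius (lpUnitBall p n)) ∧
    (p ≤ 2 →
      1 / (3 * Real.exp (1 / 3)) * (1 / (n : ℝ)) ^ (1 - 1 / p.toReal)
          ≤ bohrRadius (lpUnitBall p n) ∧
        bohrRadius (lpUnitBall p n) < 3 * (Real.log n / n) ^ (1 - 1 / p.toReal)) ∧
    (2 ≤ p →
      1 / 3 * Real.sqrt (1 / (n : ℝ)) ≤ bohrRadius (lpUnitBall p n) ∧
        bohrRadius (lpUnitBall p n) < 2 * Real.sqrt (Real.log n / n)) := by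
  have hn0 : 0 < n := by omega
  have hmem := sqrt_mem_bohrRadii hn0 (isReinhardt_lpUnitBall (n := n) hp)
  have hK := isGreatest_bohrRadius_lpUnitBall hn0 hp ⟨_, hmem⟩
  refine ⟨hK, fun h2 => ⟨hK.2 (rpow_mem_bohrRadii_lpUnitBall hn0 hp
    (ne_top_of_le_ne_top (by norm_num) h2)), lt_three_mul_of_mem_bohrRadii hn hp h2 hK.1⟩,
    fun h2 => ⟨hK.2 hmem, lt_two_mul_sqrt_of_mem_bohrRadii hn h2 hK.1⟩⟩
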